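/- Let $n\ge 1$, $\sigma\in(0,\infty)$, $\eta\in(1,\infty)$, $\varepsilon>0$ and $p>1$, and let $\mathcal A=(-\Delta)^\sigma$ on $\mathbb R^n$, where $(-\Delta)^{\gamma}f=\mathcal F^{-1}(|\xi|^{2\gamma}\mathcal F f)$. Consider the Cauchy problem $$u_{ttt}+\mathcal A u+\eta\mathcal A^{1/3}u_{tt}+\eta\mathcal A^{2/3}u_t=|u|^p,\qquad (u,u_t,u_{tt})(0,x)=\varepsilon(u_0,u_1,u_2)(x),\qquad x\in\mathbb R^n,\ t>0,$$ with real-valued $u_0,u_1,u_2\in L^1(\mathbb R^n)$ and $\int_{\mathbb R^n}u_2\,dx>0$. Test functions. Fix $s\in(0,1)$ that is smaller than the fractional part of each of the numbers $\frac{\sigma}{3},\frac{2\sigma}{3},\sigma$ which is not an integer. Fix a non-increasing $\zeta\in C^\infty$ with $\zeta=1$ on $[0,\frac12]$ and $\zeta=0$ on $[1,\infty)$. For $R>0$ and $K\ge1$ put $\varphi_R(x)=\langle R^{-1}K^{-1}x\rangle^{-n-2s}$ with $\langle x\rangle=\sqrt{1+|x|^2}$, and $\zeta_R(t)=\zeta(R^{-2\sigma/3}t)$.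 Weak solutions. For $0<T\le\infty$, a measurable real-valued function $u$ is a weak solution on $[0,T)$ if for all $K\ge1$ and all $R>0$ with $R^{2\sigma/3}<T$ the space-time integrals below converge absolutely and $$\varepsilon\int_{\mathbb R^n}\big(\eta u_0\mathcal A^{2/3}\varphi_R+\eta u_1\mathcal A^{1/3}\varphi_R+u_2\varphi_R\big)dx+\int_0^\infty\!\!\int_{\mathbb R^n}|u|^p\varphi_R\zeta_R\,dx\,dt=\int_0^\infty\!\!\int_{\mathbb R^n}u\,\big(-\partial_t^3+\mathcal A+\eta\mathcal A^{1/3}\partial_t^2-\eta\mathcal A^{2/3}\partial_t\big)(\varphi_R\zeta_R)\,dx\,dt .$$ Theorem. Let $p_{\mathrm{crit}}(n,\sigma)=1+\frac{6\sigma}{(3n-4\sigma)_+}$, understood as $+\infty$ if $3n\le4\sigma$. If $1<p\le p_{\mathrm{crit}}(n,\sigma)$, then every local (in time) weak solution, in particular every non-trivial one, blows up in finite time. That is, for every weak solution $u$ on some $[0,T)$ there is a finite $T_{\max}$ such that any weak solution on an interval $[0,T')$ with $T'\ge T$ which coincides almost everywhere with $u$ on $(0,T)\times\mathbb R^n$ has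 $T'\le T_{\max}$; in particular no weak solution is global. -/

import Mathlib

open MeasureTheory Set
open scoped FourierTransform ContDiff

noncomputable section

namespace ThirdOrder

/-- Euclidean space `ℝⁿ`. -/
abbrev Space (n : ℕ) : Type := EuclideanSpace ℝ (Fin n)

/-- The critical exponent `1 + 6σ / (3n - 4σ)₊`, equal to `+∞` when `3n ≤ 4σ`. -/
def pCrit (n : ℕ) (σ : ℝ) : EReal :=
  if 3 * (n : ℝ) ≤ 4 * σ then ⊤ else ((1 + 6 * σ / (3 * (n : ℝ) - 4 * σ) : ℝ) : EReal)

/-- The fractional Laplacian `(-Δ)^γ f = 𝓕⁻¹ (|ξ|^{2γ} 𝓕 f)`. Mathlib's Fourier transform has the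
kernel `exp (-2πi x·ξ)`, so the symbol is `(2π|ξ|)^{2γ}`. For the (real, radial) test functions to
which the operator is applied the value is real, and the real part only changes the type. -/
def fracLaplacian {n : ℕ} (γ : ℝ) (f : Space n → ℝ) (x : Space n) : ℝ :=
  (𝓕⁻ (fun ξ : Space n =>
    (((2 * Real.pi * ‖ξ‖) ^ (2 * γ) : ℝ) : ℂ) * 𝓕 (fun y : Space n => (f y : ℂ)) ξ) x).re

/-- The formal adjoint `-∂ₜ³ + 𝒜 + η 𝒜^{1/3} ∂ₜ² - η 𝒜^{2/3} ∂ₜ`, with `𝒜 = (-Δ)^σ`, of the linear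
part of the equation, applied to `ψ = ψ(t,x)`. -/
def adjointOp {n : ℕ} (σ η : ℝ) (ψ : ℝ → Space n → ℝ) (t : ℝ) (x : Space n) : ℝ :=
  - iteratedDeriv 3 (fun τ => ψ τ x) t
    + fracLaplacian σ (ψ t) x
    + η * fracLaplacian (σ / 3) (fun y => iteratedDeriv 2 (fun τ => ψ τ y) t) x
    - η * fracLaplacian (2 * σ / 3) (fun y => deriv (fun τ => ψ τ y) t) x

/-- The admissible parameters `s` in the spatial weight `⟨x⟩^{-n-2s}`: `s ∈ (0,1)` is smaller than
the fractional part of each of the orders `σ/3`, `2σ/3`, `σ` that is not an integer. -/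
def AdmissibleWeight (σ s : ℝ) : Prop :=
  0 < s ∧ s < 1 ∧ ∀ γ ∈ ({σ / 3, 2 * σ / 3, σ} : Set ℝ), Int.fract γ ≠ 0 → s < Int.fract γ

/-- Smooth non-increasing time cutoffs, equal to `1` on `[0,1/2]` and to `0` on `[1,∞)`. (Only the
values at positive times matter; to the left of `0` the cutoff is continued by `1`.) -/
structure IsTimeCutoff (ζ : ℝ → ℝ) : Prop where
  smooth : ContDiff ℝ ∞ ζ
  antitone : Antitone ζ
  eq_one : ∀ t, t ≤ 1 / 2 → ζ t = 1
  eq_zero : ∀ t, 1 ≤ t → ζ t = 0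

/-- The weight `φ_R(x) = ⟨x / (R K)⟩^{-n-2s}`, where `⟨x⟩ = √(1 + |x|²)`. -/
def spaceTest {n : ℕ} (s R K : ℝ) (x : Space n) : ℝ :=
  (Real.sqrt (1 + ‖(R * K)⁻¹ • x‖ ^ 2)) ^ (-(n : ℝ) - 2 * s)

/-- The rescaled cutoff `ζ_R(t) = ζ(R^{-2σ/3} t)`. -/
def timeTest (σ : ℝ) (ζ : ℝ → ℝ) (R t : ℝ) : ℝ := ζ (R ^ (-(2 * σ / 3)) * t)

/-- `u = u(t,x)` is a weak solution on `[0,T) × ℝⁿ`, `0 < T ≤ ∞`, of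
`u_ttt + 𝒜u + η 𝒜^{1/3}u_tt + η 𝒜^{2/3}u_t = |u|^p`, `𝒜 = (-Δ)^σ`, with the initial data
`u = ε u₀`, `u_t = ε u₁`, `u_tt = ε u₂` at `t = 0`, tested with the functions `φ_R(x) ζ_R(t)` for all
`K ≥ 1` and all `R > 0` for which `ζ_R`, supported in `[0, R^{2σ/3}]`, vanishes near time `T`. -/
structure IsWeakSolution {n : ℕ} (σ η p ε s : ℝ) (ζ : ℝ → ℝ) (u₀ u₁ u₂ : Space n → ℝ)
    (T : EReal) (u : ℝ → Space n → ℝ) : Prop where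
  pos : 0 < T
  measurable : AEStronglyMeasurable (fun z : ℝ × Space n => u z.1 z.2)
    (volume.restrict {z : ℝ × Space n | 0 < z.1 ∧ (z.1 : EReal) < T})
  integrable_nonlinear : ∀ R K : ℝ, 0 < R → 1 ≤ K → ((R ^ (2 * σ / 3) : ℝ) : EReal) < T →
    IntegrableOn (fun z : ℝ × Space n =>
      |u z.1 z.2| ^ p * (spaceTest s R K z.2 * timeTest σ ζ R z.1)) (Ioi 0 ×ˢ univ)
  integrable_linear : ∀ R K : ℝ, 0 < R → 1 ≤ K → ((R ^ (2 * σ / 3) : ℝ) : EReal) < T →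
    IntegrableOn (fun z : ℝ × Space n =>
      u z.1 z.2 * adjointOp σ η (fun t x => spaceTest s R K x * timeTest σ ζ R t) z.1 z.2)
      (Ioi 0 ×ˢ univ)
  identity : ∀ R K : ℝ, 0 < R → 1 ≤ K → ((R ^ (2 * σ / 3) : ℝ) : EReal) < T →
    ε * (∫ x : Space n,
        (η * u₀ x * fracLaplacian (2 * σ / 3) (spaceTest s R K) x
          + η * u₁ x * fracLaplacian (σ / 3) (spaceTest s R K) x
          + u₂ x * spaceTest s R K x))
      + ∫ z in (Ioi (0 : ℝ)) ×ˢ (univ : Set (Space n)),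
          |u z.1 z.2| ^ p * (spaceTest s R K z.2 * timeTest σ ζ R z.1)
    = ∫ z in (Ioi (0 : ℝ)) ×ˢ (univ : Set (Space n)),
        u z.1 z.2 * adjointOp σ η (fun t x => spaceTest s R K x * timeTest σ ζ R t) z.1 z.2

/-- The weak solution `u` on `[0,T)` blows up in finite time: there is a finite time beyond which
no weak solution continuing `u` exists (in particular `T` is finite and `u` has no global
continuation). -/
def BlowsUpInFiniteTime {n : ℕ} (σ η p ε s : ℝ) (ζ : ℝ → ℝ) (u₀ u₁ u₂ : Space n → ℝ)
    (T : EReal) (u : ℝ → Space n → ℝ) : Prop :=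
  ∃ Tmax : ℝ, ∀ (T' : EReal) (v : ℝ → Space n → ℝ),
    T ≤ T' → IsWeakSolution σ η p ε s ζ u₀ u₁ u₂ T' v →
    (∀ᵐ z : ℝ × Space n, 0 < z.1 → (z.1 : EReal) < T → v z.1 z.2 = u z.1 z.2) →
    T' ≤ (Tmax : EReal)

end ThirdOrder

end

/-!
The proof is by test functions, and it bounds the lifespan of every weak solution by a time that
depends on the data only.

*Spatial weights.* With `q = n + 2s`, the weight `⟨x⟩^{-q}` satisfies
`|(-Δ)^γ ⟨x⟩^{-q}| ≤ C ⟨x⟩^{-q}` for every real `γ > s` (`multiplier_bracketPow_decay`), and an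
admissible `s` is smaller than each of the orders `σ/3`, `2σ/3`, `σ`. Pointwise formulas for the
fractional Laplacian are avoided by subordinating twice to Gaussians. First, `⟨x⟩^{-q}` is a Gamma
integral of Gaussians, so that its image under `(-Δ)^γ` is a superposition of the kernels with
symbols `|ξ|^{2γ} exp (-a |ξ|²)`. Second, for an integer `m > γ` such a symbol is the
superposition `Γ(m - γ)⁻¹ ∫ t^{m-γ-1} |ξ|^{2m} exp (-(a + t) |ξ|²) dt` of Schwartz functions.
Scaling determines how the constant in the decay `|x|^{-q}` of a single kernel depends on its
parameter (`heatKernel_decay_scaling`), and both parameter integrals of these constants converge,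
the one over `t` at infinity because `s < γ` (`superposition_decay`).

*Time cutoff.* Since `ζ` is monotone, it is bounded on `[t, ∞)` by `ζ t`. Landau's inequality on
that half-line, iterated, therefore gives `|ζ^{(k)}| ≤ C ζ^{1/p}` without any further assumption
on `ζ` (`IsTimeCutoff.exists_iteratedDeriv_le_rpow_inv`).

*Estimate.* Let `I` be the nonlinear term at the scales `R`, `K`, and `J` its part on the time
layer `[τ/2, τ]`, `τ = R^{2σ/3}`, where `ζ_R` varies. Young's inequality gives, for all `μ > 0`
and `R ≥ 1`, `ε D + I ≤ μ J + I/4 + C (μ^{-1/(p-1)} K^n + K^{n - 2σp'})`, where `D` is the data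
term and `p' = p / (p - 1)` (`exists_mass_estimate`). The last summand stems from a term with the
factor `R^{n + 2σ/3 - 2σp'}`, whose exponent is nonpositive exactly because `p ≤ p_crit`; then
`n - 2σp' < 0` as well. As `D → ∫ u₂ > 0` for `R → ∞` (`tendsto_dataTerm`), a large `K` followed
by a large `μ` yields a lower bound `J ≥ κ > 0` at all large scales, whereas `μ = 1/4` yields an
upper bound for `I`.

*Conclusion.* The layers that end at the times `τ₀ 4^j` are disjoint, so that `N κ ≤ I ≤ C₁` at
the scale with `R^{2σ/3} = τ₀ 4^N` (`sum_layerMass_le`). This limits the number `N` of layers that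
fit into the interval of existence, also at the critical exponent, where `R` alone gives no
smallness.
-/

namespace ThirdOrder
open Real
open scoped SchwartzMap

/-! ### The Gaussian as a Schwartz function -/

section
variable {V : Type*} [NormedAddCommGroup V] [InnerProductSpace ℝ V]

theorem exists_pow_mul_exp_neg_sq_le (N : ℕ) :
    ∃ C : ℝ, ∀ r : ℝ, 0 ≤ r → (1 + r) ^ N * rexp (-r ^ 2) ≤ C := by
  refine ⟨N.factorial * rexp 2, fun r hr => ?_⟩
  have h1 : (1 + r) ^ N / N.factorial ≤ rexp (1 + r) :=
    Real.pow_div_factorial_le_exp _ (by linarith) N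
  have h2 : (1 + r) ^ N ≤ N.factorial * rexp (1 + r) := by
    rw [div_le_iff₀ (by positivity)] at h1
    linarith
  calc (1 + r) ^ N * rexp (-r ^ 2) ≤ N.factorial * rexp (1 + r) * rexp (-r ^ 2) := by gcongr
    _ = N.factorial * rexp (1 + r + -r ^ 2) := by rw [Real.exp_add (1 + r)]; ring
    _ ≤ _ := by gcongr; nlinarith [sq_nonneg (r - 1/2)]

/-- Faà di Bruno's formula bounds the derivatives of the Gaussian by the Gaussian times a power of
`1 + ‖x‖`. -/
theorem exp_neg_norm_sq_decay (k n : ℕ) :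
    ∃ C : ℝ, ∀ x : V, ‖x‖ ^ k * ‖iteratedFDeriv ℝ n (fun x : V => rexp (-‖x‖ ^ 2)) x‖ ≤ C := by
  obtain ⟨j, D, hD, hb⟩ :=
    (Function.hasTemperateGrowth_norm_sq (H := V)).norm_iteratedFDeriv_le_uniform n
  obtain ⟨C, hC⟩ := exists_pow_mul_exp_neg_sq_le (k + j * n)
  refine ⟨n.factorial * (D + 1) ^ n * C, fun x => ?_⟩
  have hcomp : (fun x : V => rexp (-‖x‖ ^ 2)) =
      (fun r : ℝ => rexp (-r)) ∘ (fun x : V => ‖x‖ ^ 2) := rfl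
  have key : ‖iteratedFDeriv ℝ n (fun x : V => rexp (-‖x‖ ^ 2)) x‖ ≤
      n.factorial * rexp (-‖x‖ ^ 2) * ((D + 1) * (1 + ‖x‖) ^ j) ^ n := by
    rw [hcomp]
    refine norm_iteratedFDeriv_comp_le (N := n) (by fun_prop) ((contDiff_norm_sq ℝ)) le_rfl x ?_ ?_
    · intro i _
      rw [norm_iteratedFDeriv_eq_norm_iteratedDeriv, iteratedDeriv_comp_neg i Real.exp]
      simp [iteratedDeriv_eq_iterate]
    · intro i hi hin
      refine (hb i hin x).trans ?_
      have h1 : 1 ≤ (D + 1) * (1 + ‖x‖) ^ j := by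
        have : (1:ℝ) ≤ (1 + ‖x‖) ^ j := one_le_pow₀ (by linarith [norm_nonneg x])
        nlinarith
      calc D * (1 + ‖x‖) ^ j ≤ (D + 1) * (1 + ‖x‖) ^ j := by gcongr; linarith
        _ ≤ _ := le_self_pow₀ h1 (by omega)
  calc _ ≤ (1 + ‖x‖) ^ k * (n.factorial * rexp (-‖x‖ ^ 2) * ((D + 1) * (1 + ‖x‖) ^ j) ^ n) := by
        gcongr; linarith [norm_nonneg x]
    _ = n.factorial * (D + 1) ^ n * ((1 + ‖x‖) ^ (k + j * n) * rexp (-‖x‖ ^ 2)) := by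
        rw [mul_pow, pow_add, pow_mul]; ring
    _ ≤ _ := by gcongr; exact hC _ (norm_nonneg x)

/-- The Gaussian `exp (-‖x‖²)` as a Schwartz function. -/
noncomputable def gaussianSchwartz (V : Type*) [NormedAddCommGroup V] [InnerProductSpace ℝ V] :
    𝓢(V, ℝ) where
  toFun x := rexp (-‖x‖ ^ 2)
  smooth' := ((contDiff_norm_sq ℝ).neg).exp
  decay' k n := exp_neg_norm_sq_decay k n

end

/-! ### Heat symbols and their kernels -/

section
variable {V : Type*} [NormedAddCommGroup V]

/-- The symbol `|ξ|^{2γ} exp (-a |ξ|²)` of a power of the Laplacian composed with a heat flow. -/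
noncomputable def heatSymbol (γ a : ℝ) (ξ : V) : ℝ := ‖ξ‖ ^ (2 * γ) * rexp (-(a * ‖ξ‖ ^ 2))

theorem heatSymbol_nonneg (γ a : ℝ) (ξ : V) : 0 ≤ heatSymbol γ a ξ := by
  unfold heatSymbol; positivity

theorem continuous_heatSymbol {γ : ℝ} (hγ : 0 ≤ γ) (a : ℝ) :
    Continuous (heatSymbol γ a : V → ℝ) := by
  unfold heatSymbol
  exact (continuous_norm.rpow_const (fun _ => Or.inr (by linarith))).mul (by fun_prop)

end

section
variable {V : Type*} [NormedAddCommGroup V] [InnerProductSpace ℝ V]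

theorem heatSymbol_scaling (γ : ℝ) {a : ℝ} (ha : 0 < a) (ξ : V) :
    heatSymbol γ a ξ = a ^ (-γ) * heatSymbol γ 1 (√a • ξ) := by
  unfold heatSymbol
  have h1 : ‖√a • ξ‖ = √a * ‖ξ‖ := by rw [norm_smul, Real.norm_of_nonneg (Real.sqrt_nonneg _)]
  have h2 : (√a) ^ (2 * γ) = a ^ γ := by
    rw [Real.sqrt_eq_rpow, ← Real.rpow_mul ha.le]; congr 1; ring
  rw [h1, Real.mul_rpow (Real.sqrt_nonneg _) (norm_nonneg _), h2, mul_pow, Real.sq_sqrt ha.le,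
    Real.rpow_neg ha.le, one_mul]
  have : a ^ γ ≠ 0 := (Real.rpow_pos_of_pos ha γ).ne'
  field_simp

variable [FiniteDimensional ℝ V] [MeasurableSpace V] [BorelSpace V]

theorem fourier_comp_smul (f : V → ℂ) {c : ℝ} (hc : 0 < c) (x : V) :
    𝓕 (fun ξ => f (c • ξ)) x
      = ((c ^ (-(Module.finrank ℝ V : ℝ)) : ℝ) : ℂ) * 𝓕 f (c⁻¹ • x) := by
  rw [Real.fourier_eq, Real.fourier_eq]
  have h := Measure.integral_comp_smul (volume : Measure V)
    (fun v => Real.fourierChar (-(inner ℝ v (c⁻¹ • x))) • f v) c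
  have e : ∀ v : V, inner ℝ (c • v) (c⁻¹ • x) = inner ℝ v x := fun v => by
    rw [inner_smul_left, inner_smul_right]; simp [hc.ne']
  simp only [e] at h
  rw [h, Complex.real_smul, abs_of_pos (by positivity), Real.rpow_neg hc.le, Real.rpow_natCast]

theorem fourierInv_comp_smul (f : V → ℂ) {c : ℝ} (hc : 0 < c) (x : V) :
    𝓕⁻ (fun ξ => f (c • ξ)) x
      = ((c ^ (-(Module.finrank ℝ V : ℝ)) : ℝ) : ℂ) * 𝓕⁻ f (c⁻¹ • x) := by
  rw [Real.fourierInv_eq_fourier_neg, Real.fourierInv_eq_fourier_neg, fourier_comp_smul f hc,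
    smul_neg]

theorem fourier_const_mul (c : ℂ) (f : V → ℂ) (x : V) :
    𝓕 (fun ξ => c * f ξ) x = c * 𝓕 f x := by
  rw [Real.fourier_eq, Real.fourier_eq, ← integral_const_mul]
  congr 1; ext v; simp only [Circle.smul_def, smul_eq_mul]; ring

theorem fourierInv_const_mul (c : ℂ) (f : V → ℂ) (x : V) :
    𝓕⁻ (fun ξ => c * f ξ) x = c * 𝓕⁻ f x := by
  rw [Real.fourierInv_eq_fourier_neg, Real.fourierInv_eq_fourier_neg, fourier_const_mul]

theorem norm_fourier_le (f : V → ℂ) (x : V) : ‖𝓕 f x‖ ≤ ∫ v, ‖f v‖ := by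
  rw [Real.fourier_eq]
  refine (norm_integral_le_integral_norm _).trans_eq ?_
  simp [Circle.norm_smul]

theorem norm_fourierInv_le (f : V → ℂ) (x : V) : ‖𝓕⁻ f x‖ ≤ ∫ v, ‖f v‖ := by
  rw [Real.fourierInv_eq_fourier_neg]; exact norm_fourier_le f _

/-- The Fourier transform commutes with an absolutely convergent superposition. -/
theorem fourier_integral_comm {ν : Measure ℝ} [SFinite ν] {g : ℝ → V → ℂ}
    (hg : Integrable (Function.uncurry g) (ν.prod volume)) (x : V) :
    𝓕 (fun ξ => ∫ t, g t ξ ∂ν) x = ∫ t, 𝓕 (g t) x ∂ν := by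
  simp only [Real.fourier_eq]
  rw [integral_integral_swap]
  · congr 1; ext v; simp only [Circle.smul_def]; rw [integral_smul]
  · refine (Integrable.mono (g := Function.uncurry g) hg ?_ ?_)
    · refine AEStronglyMeasurable.fun_smul
        (f := fun z : ℝ × V => Real.fourierChar (-(inner ℝ z.2 x))) ?_ hg.1
      exact (Real.continuous_fourierChar.comp (by fun_prop)).aestronglyMeasurable
    · refine Filter.Eventually.of_forall fun z => ?_
      simp [Function.uncurry, Circle.norm_smul]

theorem fourierInv_integral_comm {ν : Measure ℝ} [SFinite ν] {g : ℝ → V → ℂ}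
    (hg : Integrable (Function.uncurry g) (ν.prod volume)) (x : V) :
    𝓕⁻ (fun ξ => ∫ t, g t ξ ∂ν) x = ∫ t, 𝓕⁻ (g t) x ∂ν := by
  simp only [Real.fourierInv_eq_fourier_neg]; exact fourier_integral_comm hg _

theorem integrable_heatSymbol_one {γ : ℝ} (hγ : 0 ≤ γ) :
    Integrable (heatSymbol γ 1 : V → ℝ) := by
  obtain ⟨m, hm⟩ := exists_nat_ge (2 * γ)
  have h := ((gaussianSchwartz V).integrable_pow_mul volume m).add
    ((gaussianSchwartz V).integrable_pow_mul volume 0)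
  refine h.mono (continuous_heatSymbol hγ 1).aestronglyMeasurable (.of_forall fun x => ?_)
  have e : ‖gaussianSchwartz V x‖ = rexp (-‖x‖ ^ 2) := Real.norm_of_nonneg (Real.exp_pos _).le
  rw [Real.norm_of_nonneg (heatSymbol_nonneg _ _ _)]
  refine le_trans ?_ (le_abs_self _)
  simp only [Pi.add_apply, e, heatSymbol, one_mul, ← add_mul]
  gcongr
  rcases le_total ‖x‖ 1 with h1 | h1
  · have := Real.rpow_le_one (norm_nonneg x) h1 (by linarith : 0 ≤ 2 * γ)
    have : 0 ≤ ‖x‖ ^ m := by positivity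
    simp; linarith
  · have := Real.rpow_le_rpow_of_exponent_le h1 hm
    rw [Real.rpow_natCast] at this
    simp; linarith

theorem integrable_heatSymbol {γ a : ℝ} (hγ : 0 ≤ γ) (ha : 0 < a) :
    Integrable (heatSymbol γ a : V → ℝ) := by
  rw [show (heatSymbol γ a : V → ℝ) = fun ξ => a ^ (-γ) * heatSymbol γ 1 (√a • ξ) from
    funext (heatSymbol_scaling γ ha)]
  exact ((integrable_heatSymbol_one hγ).comp_smul (Real.sqrt_pos.2 ha).ne').const_mul _

theorem sqrt_rpow_neg_eq {a : ℝ} (ha : 0 < a) (d : ℝ) : (√a) ^ (-d) = a ^ (-d / 2) := by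
  rw [Real.sqrt_eq_rpow, ← Real.rpow_mul ha.le]; congr 1; ring

theorem integral_heatSymbol (γ : ℝ) {a : ℝ} (ha : 0 < a) :
    ∫ ξ : V, heatSymbol γ a ξ
      = a ^ (-γ - (Module.finrank ℝ V : ℝ) / 2) * ∫ ξ : V, heatSymbol γ 1 ξ := by
  simp only [heatSymbol_scaling γ ha]
  rw [integral_const_mul, Measure.integral_comp_smul, abs_of_pos (by positivity), smul_eq_mul,
    ← Real.rpow_natCast, ← Real.rpow_neg (Real.sqrt_nonneg _), sqrt_rpow_neg_eq ha, ← mul_assoc,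
    ← Real.rpow_add ha]
  congr 2; ring

/-- The scaling of the convolution kernel with symbol `heatSymbol γ a`, for its decay at the
rate `|x|^{-q}`. -/
theorem heatKernel_decay_scaling {γ q C : ℝ}
    (h : ∀ x : V, ‖x‖ ^ q * ‖𝓕⁻ (fun ξ : V => (heatSymbol γ 1 ξ : ℂ)) x‖ ≤ C)
    {a : ℝ} (ha : 0 < a) (x : V) :
    ‖x‖ ^ q * ‖𝓕⁻ (fun ξ : V => (heatSymbol γ a ξ : ℂ)) x‖
      ≤ C * a ^ ((q - Module.finrank ℝ V) / 2 - γ) := by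
  have hs : 0 < √a := Real.sqrt_pos.2 ha
  simp only [heatSymbol_scaling γ ha, Complex.ofReal_mul]
  rw [fourierInv_const_mul, fourierInv_comp_smul (fun ξ : V => (heatSymbol γ 1 ξ : ℂ)) hs,
    norm_mul, norm_mul, Complex.norm_of_nonneg (by positivity),
    Complex.norm_of_nonneg (by positivity)]
  have hx : ‖x‖ ^ q = a ^ (q / 2) * ‖(√a)⁻¹ • x‖ ^ q := by
    rw [norm_smul, Real.norm_of_nonneg (by positivity),
      Real.mul_rpow (by positivity) (by positivity), ← mul_assoc,
      Real.inv_rpow hs.le, ← Real.rpow_neg hs.le, sqrt_rpow_neg_eq ha,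
      ← Real.rpow_add ha]
    simp [neg_div]
  rw [hx, sqrt_rpow_neg_eq ha]
  calc _ = (a ^ (q / 2) * a ^ (-γ) * a ^ (-(Module.finrank ℝ V : ℝ) / 2)) *
        (‖(√a)⁻¹ • x‖ ^ q * ‖𝓕⁻ (fun ξ : V => (heatSymbol γ 1 ξ : ℂ)) ((√a)⁻¹ • x)‖) := by ring
    _ ≤ (a ^ (q / 2) * a ^ (-γ) * a ^ (-(Module.finrank ℝ V : ℝ) / 2)) * C := by gcongr; exact h _
    _ = _ := by
      rw [← Real.rpow_add ha, ← Real.rpow_add ha, mul_comm]; congr 2; ring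

/-- For integer powers the symbol is a Schwartz function, so the kernel decays rapidly. -/
theorem heatKernel_natCast_decay (m : ℕ) {q : ℝ} (hq : 0 ≤ q) :
    ∃ C : ℝ, ∀ x : V, ‖x‖ ^ q * ‖𝓕⁻ (fun ξ : V => (heatSymbol m 1 ξ : ℂ)) x‖ ≤ C := by
  let F : 𝓢(V, ℂ) := SchwartzMap.postcompCLM Complex.ofRealCLM
    (SchwartzMap.smulLeftCLM ℝ (fun x : V => (‖x‖ ^ 2) ^ m) (gaussianSchwartz V))
  have hF : (F : V → ℂ) = fun ξ : V => (heatSymbol m 1 ξ : ℂ) := by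
    ext ξ
    have ht : (fun x : V => (‖x‖ ^ 2) ^ m).HasTemperateGrowth :=
      (Function.hasTemperateGrowth_norm_sq (H := V)).pow m
    simp only [F, SchwartzMap.postcompCLM_apply, SchwartzMap.smulLeftCLM_apply_apply ht, heatSymbol]
    rw [show (2 * (m : ℝ)) = ((2 * m : ℕ) : ℝ) by push_cast; ring, Real.rpow_natCast,
      pow_mul, one_mul]
    rfl
  rw [← hF, ← SchwartzMap.fourierInv_coe]
  obtain ⟨N, hN⟩ := exists_nat_ge q
  obtain ⟨C₀, -, h0⟩ := (𝓕⁻ F).decay 0 0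
  obtain ⟨C₁, -, h1⟩ := (𝓕⁻ F).decay N 0
  refine ⟨C₀ + C₁, fun x => ?_⟩
  have h0 := h0 x
  have h1 := h1 x
  simp only [pow_zero, one_mul, norm_iteratedFDeriv_zero] at h0 h1
  have : ‖x‖ ^ q ≤ 1 + ‖x‖ ^ N := by
    rcases le_total ‖x‖ 1 with h1 | h1
    · have := Real.rpow_le_one (norm_nonneg x) h1 hq
      have : 0 ≤ ‖x‖ ^ N := by positivity
      linarith
    · have := Real.rpow_le_rpow_of_exponent_le h1 hN
      rw [Real.rpow_natCast] at this
      linarith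
  calc _ ≤ (1 + ‖x‖ ^ N) * ‖(𝓕⁻ F) x‖ := by gcongr
    _ ≤ _ := by linarith

end

/-! ### Superpositions of heat symbols -/

section
variable {V : Type*} [NormedAddCommGroup V]

theorem integrableOn_rpow_mul_one_add_rpow {α β : ℝ} (hα : 0 < α) (hβ : α < β) :
    IntegrableOn (fun t : ℝ => t ^ (α - 1) * (1 + t) ^ (-β)) (Ioi 0) := by
  rw [← Ioc_union_Ioi_eq_Ioi (zero_le_one (α := ℝ))]
  have hm : Measurable (fun t : ℝ => t ^ (α - 1) * (1 + t) ^ (-β)) := by fun_prop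
  refine IntegrableOn.union ?_ ?_
  · have h : IntegrableOn (fun t : ℝ => t ^ (α - 1)) (Ioc 0 1) :=
      (intervalIntegral.intervalIntegrable_rpow' (by linarith)).1
    refine Integrable.mono h hm.aestronglyMeasurable ?_
    refine (ae_restrict_mem measurableSet_Ioc).mono fun t ht => ?_
    have h0 : 0 ≤ t ^ (α - 1) := Real.rpow_nonneg ht.1.le _
    rw [norm_mul]
    refine mul_le_of_le_one_right (norm_nonneg _) ?_
    rw [Real.norm_of_nonneg (Real.rpow_nonneg (by linarith [ht.1]) _)]
    exact Real.rpow_le_one_of_one_le_of_nonpos (by linarith [ht.1]) (by linarith)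
  · have h : IntegrableOn (fun t : ℝ => t ^ (α - 1 - β)) (Ioi 1) :=
      integrableOn_Ioi_rpow_of_lt (by linarith) one_pos
    refine Integrable.mono h hm.aestronglyMeasurable ?_
    refine (ae_restrict_mem measurableSet_Ioi).mono fun t ht => ?_
    have ht0 : (0 : ℝ) < t := one_pos.trans ht
    rw [Real.norm_of_nonneg (by positivity), Real.norm_of_nonneg (by positivity),
      sub_eq_add_neg (α - 1), Real.rpow_add ht0 (α - 1)]
    exact mul_le_mul_of_nonneg_left
      (Real.rpow_le_rpow_of_nonpos ht0 (by linarith) (by linarith)) (by positivity)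

/-- Subordination: a fractional power of `|ξ|²` is a superposition of heat symbols carrying an
integer power. -/
theorem heatSymbol_eq_superposition {γ : ℝ} (hγ : 0 < γ) {m : ℕ} (hm : γ < m) (ξ : V) :
    heatSymbol γ 1 ξ = (Real.Gamma (m - γ))⁻¹ *
      ∫ t in Ioi (0 : ℝ), t ^ ((m - γ) - 1) * heatSymbol m (1 + t) ξ := by
  have hα : 0 < m - γ := by linarith
  have hm0 : (0 : ℝ) < m := by linarith
  rcases eq_or_ne ξ 0 with rfl | hξ
  · simp [heatSymbol, hγ.ne', hm0.ne']
  have hr : 0 < ‖ξ‖ := norm_pos_iff.2 hξ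
  have : ∀ t : ℝ, t ^ ((m - γ) - 1) * heatSymbol m (1 + t) ξ
      = heatSymbol m 1 ξ * (t ^ ((m - γ) - 1) * rexp (-(‖ξ‖ ^ 2 * t))) := fun t => by
    unfold heatSymbol
    rw [show -((1 + t) * ‖ξ‖ ^ 2) = -(1 * ‖ξ‖ ^ 2) + -(‖ξ‖ ^ 2 * t) by ring, Real.exp_add]; ring
  simp only [this]
  rw [integral_const_mul, Real.integral_rpow_mul_exp_neg_mul_Ioi hα (by positivity)]
  have hG : Real.Gamma (m - γ) ≠ 0 := (Real.Gamma_pos_of_pos hα).ne'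
  have e : (1 / ‖ξ‖ ^ 2) ^ ((m : ℝ) - γ) = ‖ξ‖ ^ (2 * γ - 2 * m) := by
    rw [one_div, Real.inv_rpow (by positivity), ← Real.rpow_natCast, ← Real.rpow_mul hr.le,
      ← Real.rpow_neg hr.le]
    congr 1; push_cast; ring
  rw [e]
  unfold heatSymbol
  have : ‖ξ‖ ^ (2 * γ) = ‖ξ‖ ^ (2 * (m : ℝ)) * ‖ξ‖ ^ (2 * γ - 2 * m) := by
    rw [← Real.rpow_add hr]; congr 1; ring
  rw [this]
  field_simp

/-- The Japanese bracket power `⟨x⟩^{-q}`. -/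
noncomputable def bracketPow (q : ℝ) (x : V) : ℝ := √(1 + ‖x‖ ^ 2) ^ (-q)

/-- The bracket power is a Gamma integral of Gaussians. -/
theorem bracketPow_eq_superposition {q : ℝ} (hq : 0 < q) (x : V) :
    bracketPow q x = (Real.Gamma (q / 2))⁻¹ *
      ∫ t in Ioi (0 : ℝ), (t ^ (q / 2 - 1) * rexp (-t)) * heatSymbol 0 t x := by
  have : ∀ t : ℝ, (t ^ (q / 2 - 1) * rexp (-t)) * heatSymbol 0 t x
      = t ^ (q / 2 - 1) * rexp (-((1 + ‖x‖ ^ 2) * t)) := fun t => by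
    unfold heatSymbol
    rw [show -((1 + ‖x‖ ^ 2) * t) = -t + -(t * ‖x‖ ^ 2) by ring, Real.exp_add]
    simp [mul_assoc]
  simp only [this]
  rw [Real.integral_rpow_mul_exp_neg_mul_Ioi (by positivity) (by positivity)]
  have hG : Real.Gamma (q / 2) ≠ 0 := (Real.Gamma_pos_of_pos (by positivity)).ne'
  rw [bracketPow, Real.sqrt_eq_rpow, ← Real.rpow_mul (by positivity), one_div (1 + ‖x‖ ^ 2),
    Real.inv_rpow (by positivity), ← Real.rpow_neg (by positivity)]
  field_simp

theorem integrableOn_multiplier_weight {γ s δ : ℝ} (h : 0 < s + δ) (hγ : γ = -δ) :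
    IntegrableOn (fun t : ℝ => (t ^ (s - 1) * rexp (-t)) * (π ^ 2 / t) ^ γ) (Ioi 0) := by
  refine IntegrableOn.congr_fun
    (Integrable.const_mul (Real.GammaIntegral_convergent h) ((π ^ 2) ^ γ))
    (fun t ht => ?_) measurableSet_Ioi
  have ht : (0 : ℝ) < t := ht
  rw [Real.div_rpow (by positivity) ht.le, hγ, Real.rpow_neg ht.le, div_inv_eq_mul,
    show s + δ - 1 = (s - 1) + δ by ring, Real.rpow_add ht]
  ring

theorem le_bracketPow_of_decay {q C₀ C₁ : ℝ} (hq : 0 < q) {F : V → ℝ} (hF : ∀ x, 0 ≤ F x)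
    (h0 : ∀ x, F x ≤ C₀) (h1 : ∀ x, ‖x‖ ^ q * F x ≤ C₁) (x : V) :
    F x ≤ 2 ^ q * (C₀ + C₁) * bracketPow q x := by
  have hb : 0 < √(1 + ‖x‖ ^ 2) := Real.sqrt_pos.2 (by positivity)
  have key : √(1 + ‖x‖ ^ 2) ^ q ≤ 2 ^ q * (1 + ‖x‖ ^ q) := by
    have hx : 0 ≤ ‖x‖ ^ q := by positivity
    have h2 : (0 : ℝ) ≤ 2 ^ q := by positivity
    rcases le_total ‖x‖ 1 with h | h
    · have : √(1 + ‖x‖ ^ 2) ≤ 2 := by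
        rw [Real.sqrt_le_left (by norm_num)]; nlinarith [norm_nonneg x]
      have := Real.rpow_le_rpow hb.le this hq.le
      nlinarith
    · have : √(1 + ‖x‖ ^ 2) ≤ 2 * ‖x‖ := by
        rw [Real.sqrt_le_left (by positivity)]; nlinarith [norm_nonneg x]
      have := Real.rpow_le_rpow hb.le this hq.le
      rw [Real.mul_rpow (by norm_num) (norm_nonneg x)] at this
      nlinarith
  have e : √(1 + ‖x‖ ^ 2) ^ q * bracketPow q x = 1 := by
    rw [bracketPow, ← Real.rpow_add hb]; simp
  have hB : 0 ≤ bracketPow q x := Real.rpow_nonneg hb.le _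
  calc F x = (√(1 + ‖x‖ ^ 2) ^ q * F x) * bracketPow q x := by
        rw [mul_right_comm, e, one_mul]
    _ ≤ (2 ^ q * (1 + ‖x‖ ^ q) * F x) * bracketPow q x := by
        gcongr; exact hF x
    _ = 2 ^ q * (F x + ‖x‖ ^ q * F x) * bracketPow q x := by ring
    _ ≤ _ := by gcongr; exacts [h0 x, h1 x]

end

section
variable {V : Type*} [NormedAddCommGroup V] [InnerProductSpace ℝ V]
variable [FiniteDimensional ℝ V] [MeasurableSpace V] [BorelSpace V]


/-- The joint integrability that Fubini's theorem needs for a superposition of heat symbols; the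
single symbol `heatSymbol γ b` has mass proportional to `b^{-γ-d/2}`. -/
theorem integrable_superposition_prod {γ : ℝ} (hγ : 0 ≤ γ) {w b : ℝ → ℝ} (hw : Measurable w)
    (hb : Measurable b) (hb0 : ∀ t ∈ Ioi (0 : ℝ), 0 < b t)
    (h : IntegrableOn (fun t => w t * b t ^ (-γ - (Module.finrank ℝ V : ℝ) / 2)) (Ioi 0)) :
    Integrable (Function.uncurry fun (t : ℝ) (ξ : V) => w t * heatSymbol γ (b t) ξ)
      ((volume.restrict (Ioi 0)).prod volume) := by
  have hm : Measurable (Function.uncurry fun (t : ℝ) (ξ : V) => w t * heatSymbol γ (b t) ξ) := by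
    unfold Function.uncurry heatSymbol; fun_prop
  rw [integrable_prod_iff hm.aestronglyMeasurable]
  constructor
  · refine (ae_restrict_mem measurableSet_Ioi).mono fun t ht => ?_
    exact (integrable_heatSymbol hγ (hb0 t ht)).const_mul (w t)
  · refine (h.norm.mul_const (∫ ξ : V, heatSymbol γ 1 ξ)).congr ?_
    refine (ae_restrict_mem measurableSet_Ioi).mono fun t ht => ?_
    simp only [Function.uncurry, norm_mul, Real.norm_of_nonneg (heatSymbol_nonneg _ _ _)]
    rw [integral_const_mul, integral_heatSymbol γ (hb0 t ht),
      Real.norm_of_nonneg (Real.rpow_nonneg (hb0 t ht).le _)]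
    ring

/-- A superposition `∫ w(t) |ξ|^{2γ} exp (-b(t) |ξ|²) dt` of symbols has a kernel decaying like
`|x|^{-q}` as soon as the scaled decay constants of the single kernels can be integrated. -/
theorem superposition_decay {γ q C : ℝ} (hγ : 0 ≤ γ) {w b : ℝ → ℝ} (hw : Measurable w)
    (hb : Measurable b) (hb0 : ∀ t ∈ Ioi (0 : ℝ), 0 < b t)
    (h1 : IntegrableOn (fun t => w t * b t ^ (-γ - (Module.finrank ℝ V : ℝ) / 2)) (Ioi 0))
    (h2 : IntegrableOn (fun t => w t * b t ^ ((q - (Module.finrank ℝ V : ℝ)) / 2 - γ)) (Ioi 0))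
    (h : ∀ x : V, ‖x‖ ^ q * ‖𝓕⁻ (fun ξ : V => (heatSymbol γ 1 ξ : ℂ)) x‖ ≤ C) :
    ∃ C' : ℝ, ∀ x : V, ‖x‖ ^ q *
      ‖𝓕⁻ (fun ξ : V => ((∫ t in Ioi (0 : ℝ), w t * heatSymbol γ (b t) ξ : ℝ) : ℂ)) x‖ ≤ C' := by
  refine ⟨∫ t in Ioi (0 : ℝ), C * ‖w t * b t ^ ((q - (Module.finrank ℝ V : ℝ)) / 2 - γ)‖,
    fun x => ?_⟩
  have hint := (integrable_superposition_prod hγ hw hb hb0 h1).ofReal (𝕜 := ℂ)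
  simp only [← integral_complex_ofReal]
  have := fourierInv_integral_comm (ν := volume.restrict (Ioi 0))
    (g := fun t (ξ : V) => ((w t * heatSymbol γ (b t) ξ : ℝ) : ℂ)) hint x
  rw [this, ← Real.norm_of_nonneg (Real.rpow_nonneg (norm_nonneg x) q),
    ← Complex.norm_real, ← norm_mul, ← integral_const_mul]
  refine norm_integral_le_of_norm_le (h2.norm.const_mul C) ?_
  refine (ae_restrict_mem measurableSet_Ioi).mono fun t ht => ?_
  simp only [Complex.ofReal_mul]
  rw [fourierInv_const_mul, norm_mul, norm_mul, norm_mul, Complex.norm_real,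
    Complex.norm_real, Real.norm_of_nonneg (Real.rpow_nonneg (norm_nonneg x) q),
    Real.norm_of_nonneg (Real.rpow_nonneg (hb0 t ht).le _)]
  have := heatKernel_decay_scaling h (hb0 t ht) x
  calc _ = ‖w t‖ * (‖x‖ ^ q * ‖𝓕⁻ (fun ξ : V => (heatSymbol γ (b t) ξ : ℂ)) x‖) := by ring
    _ ≤ ‖w t‖ * (C * b t ^ ((q - (Module.finrank ℝ V : ℝ)) / 2 - γ)) := by gcongr
    _ = _ := by ring

/-- The kernel of `(-Δ)^γ e^{Δ}` decays at every rate `|x|^{-d-2s}` with `0 ≤ s < γ`. -/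
theorem heatKernel_decay {γ s : ℝ} (hs : 0 ≤ s) (hsγ : s < γ) :
    ∃ C : ℝ, ∀ x : V, ‖x‖ ^ ((Module.finrank ℝ V : ℝ) + 2 * s) *
      ‖𝓕⁻ (fun ξ : V => (heatSymbol γ 1 ξ : ℂ)) x‖ ≤ C := by
  obtain ⟨m, hm⟩ := exists_nat_gt γ
  have hd : (0 : ℝ) ≤ Module.finrank ℝ V := Nat.cast_nonneg _
  obtain ⟨C, hC⟩ := heatKernel_natCast_decay (V := V) m
    (q := (Module.finrank ℝ V : ℝ) + 2 * s) (by positivity)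
  obtain ⟨C', hC'⟩ := superposition_decay (V := V) (w := fun t => t ^ ((m - γ) - 1))
    (b := fun t => 1 + t) (Nat.cast_nonneg m) (by fun_prop) (by fun_prop)
    (fun t ht => by have : (0 : ℝ) < t := ht; positivity)
    (by
      convert integrableOn_rpow_mul_one_add_rpow (α := m - γ)
        (β := m + (Module.finrank ℝ V : ℝ) / 2) (by linarith) (by linarith) using 4
      ring)
    (by
      convert integrableOn_rpow_mul_one_add_rpow (α := m - γ) (β := m - s)
        (by linarith) (by linarith) using 4
      ring)
    hC
  refine ⟨‖(Real.Gamma (m - γ))⁻¹‖ * C', fun x => ?_⟩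
  simp only [heatSymbol_eq_superposition (hs.trans_lt hsγ) hm, Complex.ofReal_mul]
  rw [fourierInv_const_mul, norm_mul, Complex.norm_real, mul_left_comm]
  gcongr
  exact hC' x

theorem fourier_heatSymbol_zero {t : ℝ} (ht : 0 < t) (ξ : V) :
    𝓕 (fun x : V => (heatSymbol 0 t x : ℂ)) ξ =
      (((π / t) ^ ((Module.finrank ℝ V : ℝ) / 2) * rexp (-(π ^ 2 / t * ‖ξ‖ ^ 2)) : ℝ) : ℂ) := by
  have h := fourier_gaussian_innerProductSpace (V := V) (b := (t : ℂ)) (by simpa using ht) ξ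
  have e : (fun x : V => (heatSymbol 0 t x : ℂ)) = fun x : V => Complex.exp (-t * ‖x‖ ^ 2) := by
    ext x; simp [heatSymbol]
  rw [e, h, Complex.ofReal_mul, Complex.ofReal_cpow (by positivity), Complex.ofReal_exp]
  push_cast
  congr 2
  ring

theorem fourier_bracketPow {s : ℝ} (hs : 0 < s) (ξ : V) :
    𝓕 (fun x : V => (bracketPow ((Module.finrank ℝ V : ℝ) + 2 * s) x : ℂ)) ξ =
      (((Real.Gamma (((Module.finrank ℝ V : ℝ) + 2 * s) / 2))⁻¹ *
          π ^ ((Module.finrank ℝ V : ℝ) / 2) *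
        ∫ t in Ioi (0 : ℝ),
          (t ^ (s - 1) * rexp (-t)) * rexp (-(π ^ 2 / t * ‖ξ‖ ^ 2)) : ℝ) : ℂ) := by
  set d : ℝ := (Module.finrank ℝ V : ℝ) with hd
  have hd0 : 0 ≤ d := Nat.cast_nonneg _
  have hGamma : IntegrableOn
      (fun t : ℝ => (t ^ ((d + 2 * s) / 2 - 1) * rexp (-t)) * t ^ (-0 - d / 2))
      (Ioi 0) := by
    refine (Real.GammaIntegral_convergent hs).congr_fun (fun t ht => ?_) measurableSet_Ioi
    have ht : (0 : ℝ) < t := ht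
    simp only
    rw [mul_right_comm, ← Real.rpow_add ht, mul_comm]
    congr 2; ring
  have hint := (integrable_superposition_prod (V := V) (γ := 0)
    (w := fun t => t ^ ((d + 2 * s) / 2 - 1) * rexp (-t)) (b := fun t => t) le_rfl
    (by fun_prop) (by fun_prop) (fun t ht => ht) hGamma).ofReal (𝕜 := ℂ)
  have := fourier_integral_comm (ν := volume.restrict (Ioi 0))
    (g := fun t (x : V) => (((t ^ ((d + 2 * s) / 2 - 1) * rexp (-t)) * heatSymbol 0 t x : ℝ) : ℂ))
    hint ξ
  simp only [bracketPow_eq_superposition (V := V) (q := d + 2 * s) (by positivity),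
    Complex.ofReal_mul]
  rw [fourier_const_mul, mul_assoc, ← Complex.ofReal_mul, ← integral_const_mul]
  simp only [← integral_complex_ofReal]
  rw [this]
  congr 1
  refine setIntegral_congr_fun measurableSet_Ioi fun t ht => ?_
  have ht : (0 : ℝ) < t := ht
  simp only [Complex.ofReal_mul (_ * _) (heatSymbol _ _ _)]
  rw [fourier_const_mul, fourier_heatSymbol_zero ht, ← Complex.ofReal_mul,
    Real.div_rpow pi_pos.le ht.le]
  congr 1
  have : t ^ ((d + 2 * s) / 2 - 1) = t ^ (s - 1) * t ^ (d / 2) := by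
    rw [← Real.rpow_add ht]; congr 1; ring
  rw [this]
  have : t ^ (d / 2) ≠ 0 := (Real.rpow_pos_of_pos ht _).ne'
  field_simp
  rw [← hd]

/-- The Fourier side of `(-Δ)^γ ⟨x⟩^{-d-2s}` is again a superposition of heat symbols. -/
theorem multiplier_bracketPow_eq {γ s : ℝ} (hs : 0 < s) (ξ : V) :
    (((2 * π * ‖ξ‖) ^ (2 * γ) : ℝ) : ℂ) *
        𝓕 (fun x : V => (bracketPow ((Module.finrank ℝ V : ℝ) + 2 * s) x : ℂ)) ξ =
      (((2 * π) ^ (2 * γ) * ((Real.Gamma (((Module.finrank ℝ V : ℝ) + 2 * s) / 2))⁻¹ *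
          π ^ ((Module.finrank ℝ V : ℝ) / 2)) : ℝ) : ℂ) *
        ((∫ t in Ioi (0 : ℝ), (t ^ (s - 1) * rexp (-t)) * heatSymbol γ (π ^ 2 / t) ξ : ℝ) : ℂ) := by
  have e : ∀ t : ℝ, (t ^ (s - 1) * rexp (-t)) * heatSymbol γ (π ^ 2 / t) ξ
      = ‖ξ‖ ^ (2 * γ) * ((t ^ (s - 1) * rexp (-t)) * rexp (-(π ^ 2 / t * ‖ξ‖ ^ 2))) := fun t => by
    unfold heatSymbol; ring
  simp only [e]
  rw [fourier_bracketPow hs, integral_const_mul, Real.mul_rpow (by positivity) (norm_nonneg _)]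
  push_cast
  ring

theorem multiplier_bracketPow_integrable {γ s : ℝ} (hs : 0 < s) (hsγ : s < γ) :
    Integrable (fun ξ : V => (((2 * π * ‖ξ‖) ^ (2 * γ) : ℝ) : ℂ) *
        𝓕 (fun x : V => (bracketPow ((Module.finrank ℝ V : ℝ) + 2 * s) x : ℂ)) ξ) := by
  have hd : (0 : ℝ) ≤ Module.finrank ℝ V := Nat.cast_nonneg _
  simp only [multiplier_bracketPow_eq hs]
  refine Integrable.const_mul (Integrable.ofReal ?_) _
  exact (integrable_superposition_prod (V := V) (γ := γ) (w := fun t => t ^ (s - 1) * rexp (-t))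
    (b := fun t => π ^ 2 / t) (hs.trans hsγ).le (by fun_prop) (by fun_prop)
    (fun t ht => by have : (0 : ℝ) < t := ht; positivity)
    (integrableOn_multiplier_weight (δ := γ + (Module.finrank ℝ V : ℝ) / 2) (by linarith)
      (by ring))).integral_prod_right

/-- The weight `⟨x⟩^{-d-2s}` dominates its image under `(-Δ)^γ` for every `γ > s`. -/
theorem multiplier_bracketPow_decay {γ s : ℝ} (hs : 0 < s) (hsγ : s < γ) :
    ∃ C : ℝ, ∀ x : V, ‖𝓕⁻ (fun ξ : V => (((2 * π * ‖ξ‖) ^ (2 * γ) : ℝ) : ℂ) *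
        𝓕 (fun x : V => (bracketPow ((Module.finrank ℝ V : ℝ) + 2 * s) x : ℂ)) ξ) x‖
      ≤ C * bracketPow ((Module.finrank ℝ V : ℝ) + 2 * s) x := by
  have hd : (0 : ℝ) ≤ Module.finrank ℝ V := Nat.cast_nonneg _
  obtain ⟨C, hC⟩ := heatKernel_decay (V := V) hs.le hsγ
  obtain ⟨C', hC'⟩ := superposition_decay (V := V) (γ := γ)
    (w := fun t => t ^ (s - 1) * rexp (-t))
    (b := fun t => π ^ 2 / t) (hs.trans hsγ).le (by fun_prop) (by fun_prop)
    (fun t ht => by have : (0 : ℝ) < t := ht; positivity)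
    (integrableOn_multiplier_weight (δ := γ + (Module.finrank ℝ V : ℝ) / 2) (by linarith) (by ring))
    (integrableOn_multiplier_weight (δ := γ - s) (by linarith) (by ring)) hC
  set c : ℝ := (2 * π) ^ (2 * γ) * ((Real.Gamma (((Module.finrank ℝ V : ℝ) + 2 * s) / 2))⁻¹ *
          π ^ ((Module.finrank ℝ V : ℝ) / 2)) with hc
  refine ⟨_, le_bracketPow_of_decay (by positivity) (fun x => norm_nonneg _)
    (fun x => norm_fourierInv_le _ x) (C₁ := ‖(c : ℂ)‖ * C') (fun x => ?_)⟩
  simp only [multiplier_bracketPow_eq hs]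
  rw [fourierInv_const_mul, norm_mul, mul_left_comm]
  gcongr
  exact hC' x

end

/-! ### Fractional Laplacians of the spatial weights -/

section
variable {n : ℕ}

theorem spaceTest_eq (s R K : ℝ) (x : Space n) :
    spaceTest s R K x = bracketPow ((n : ℝ) + 2 * s) ((R * K)⁻¹ • x) := by
  unfold spaceTest bracketPow; congr 1; ring

theorem fracLaplacian_const_mul (γ c : ℝ) (f : Space n → ℝ) (x : Space n) :
    fracLaplacian γ (fun y => f y * c) x = fracLaplacian γ f x * c := by
  unfold fracLaplacian
  have h : ∀ ξ, 𝓕 (fun y : Space n => ((f y * c : ℝ) : ℂ)) ξ =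
      c * 𝓕 (fun y : Space n => (f y : ℂ)) ξ := by
    intro ξ
    rw [← fourier_const_mul,
      show (fun y : Space n => ((f y * c : ℝ) : ℂ)) = fun y => (c : ℂ) * f y from
      funext fun y => by push_cast; ring]
  simp only [h, mul_left_comm _ (c : ℂ)]
  rw [fourierInv_const_mul, Complex.re_ofReal_mul, mul_comm]

theorem fracLaplacian_comp_smul (γ : ℝ) (f : Space n → ℝ) {c : ℝ} (hc : 0 < c) (x : Space n) :
    fracLaplacian γ (fun y => f (c • y)) x = c ^ (2 * γ) * fracLaplacian γ f (c • x) := by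
  unfold fracLaplacian
  set M : Space n → ℂ := fun ξ => (((2 * π * ‖ξ‖) ^ (2 * γ) : ℝ) : ℂ) *
    𝓕 (fun y : Space n => (f y : ℂ)) ξ with hM
  have h : (fun ξ : Space n => (((2 * π * ‖ξ‖) ^ (2 * γ) : ℝ) : ℂ) *
      𝓕 (fun y : Space n => (f (c • y) : ℂ)) ξ)
      = fun ξ => ((c ^ (2 * γ) * c ^ (-(Module.finrank ℝ (Space n) : ℝ)) : ℝ) : ℂ) *
        M (c⁻¹ • ξ) := by
    ext ξ
    rw [fourier_comp_smul (fun y : Space n => (f y : ℂ)) hc, hM]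
    have e : (2 * π * ‖ξ‖) ^ (2 * γ) = c ^ (2 * γ) * (2 * π * ‖c⁻¹ • ξ‖) ^ (2 * γ) := by
      rw [← Real.mul_rpow hc.le (by positivity), norm_smul, Real.norm_of_nonneg (by positivity)]
      congr 1; field_simp
    rw [e]; push_cast; ring
  rw [h, fourierInv_const_mul, fourierInv_comp_smul M (inv_pos.2 hc), inv_inv, ← mul_assoc,
    ← Complex.ofReal_mul, Complex.re_ofReal_mul, Real.inv_rpow hc.le, mul_assoc,
    mul_assoc, mul_inv_cancel_left₀ (Real.rpow_pos_of_pos hc _).ne']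

theorem fracLaplacian_spaceTest (γ s : ℝ) {R K : ℝ} (hRK : 0 < R * K) (x : Space n) :
    fracLaplacian γ (spaceTest s R K) x = (R * K) ^ (-(2 * γ)) *
      fracLaplacian γ (bracketPow ((n : ℝ) + 2 * s)) ((R * K)⁻¹ • x) := by
  rw [show (spaceTest s R K : Space n → ℝ) =
    fun y => bracketPow ((n : ℝ) + 2 * s) ((R * K)⁻¹ • y) from funext (spaceTest_eq s R K),
    fracLaplacian_comp_smul γ _ (inv_pos.2 hRK), Real.inv_rpow hRK.le, Real.rpow_neg hRK.le]

theorem continuous_fracLaplacian_spaceTest {γ s : ℝ} (hs : 0 < s) (hsγ : s < γ) {R K : ℝ}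
    (hRK : 0 < R * K) : Continuous (fracLaplacian γ (spaceTest s R K) : Space n → ℝ) := by
  have h := multiplier_bracketPow_integrable (V := Space n) hs hsγ
  rw [finrank_euclideanSpace_fin] at h
  have hc : Continuous (fracLaplacian γ (bracketPow ((n : ℝ) + 2 * s)) : Space n → ℝ) := by
    refine Complex.continuous_re.comp (g := Complex.re) ?_
    rw [funext (Real.fourierInv_eq_fourier_neg _)]
    exact (VectorFourier.fourierIntegral_continuous Real.continuous_fourierChar
      (L := innerₗ (Space n)) (by exact continuous_inner) h).comp continuous_neg
  rw [show (fracLaplacian γ (spaceTest s R K) : Space n → ℝ) = _ from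
    funext (fracLaplacian_spaceTest γ s hRK)]
  fun_prop

/-- The weights dominate their images under the fractional Laplacian, with the scaling constant of
the dilation. -/
theorem exists_fracLaplacian_spaceTest_le {γ s : ℝ} (hs : 0 < s) (hsγ : s < γ) :
    ∃ C : ℝ, 0 ≤ C ∧ ∀ R K : ℝ, 0 < R * K → ∀ x : Space n,
      |fracLaplacian γ (spaceTest s R K) x| ≤ C * (R * K) ^ (-(2 * γ)) * spaceTest s R K x := by
  obtain ⟨C, hC⟩ := multiplier_bracketPow_decay (V := Space n) hs hsγ
  rw [finrank_euclideanSpace_fin] at hC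
  have hpos : ∀ y : Space n, 0 ≤ bracketPow ((n : ℝ) + 2 * s) y := fun y =>
    Real.rpow_nonneg (Real.sqrt_nonneg _) _
  refine ⟨|C|, abs_nonneg _, fun R K hRK x => ?_⟩
  rw [fracLaplacian_spaceTest γ s hRK, abs_mul, abs_of_nonneg (Real.rpow_nonneg hRK.le _),
    spaceTest_eq, mul_comm |C|, mul_assoc]
  gcongr
  refine ((Complex.abs_re_le_norm _).trans (hC _)).trans ?_
  gcongr
  · exact hpos _
  · exact le_abs_self C

/-- For a non-integer order the fractional part is at most the order; a positive integer order
exceeds `s < 1` anyway. -/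
theorem AdmissibleWeight.lt {σ s : ℝ} (hσ : 0 < σ) (hs : AdmissibleWeight σ s) {γ : ℝ}
    (hγ : γ ∈ ({σ / 3, 2 * σ / 3, σ} : Set ℝ)) : s < γ := by
  obtain ⟨-, h1, h⟩ := hs
  have hpos : 0 < γ := by
    simp only [mem_insert_iff, mem_singleton_iff] at hγ
    rcases hγ with rfl | rfl | rfl <;> positivity
  have hfl : 0 ≤ ⌊γ⌋ := Int.floor_nonneg.2 hpos.le
  have hfl' : (0 : ℝ) ≤ ⌊γ⌋ := by exact_mod_cast hfl
  have hf := Int.floor_add_fract γ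
  by_cases h0 : Int.fract γ = 0
  · rw [h0, add_zero] at hf
    have : (0 : ℝ) < ⌊γ⌋ := by rwa [hf]
    have : 1 ≤ ⌊γ⌋ := by exact_mod_cast this
    have : (1 : ℝ) ≤ ⌊γ⌋ := by exact_mod_cast this
    linarith
  · have := h γ hγ h0
    linarith

theorem spaceTest_pos (s R K : ℝ) (x : Space n) : 0 < spaceTest s R K x :=
  Real.rpow_pos_of_pos (Real.sqrt_pos.2 (by positivity)) _

theorem continuous_spaceTest (s R K : ℝ) : Continuous (spaceTest s R K : Space n → ℝ) := by
  unfold spaceTest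
  exact Continuous.rpow_const (by fun_prop) fun x => Or.inl (Real.sqrt_pos.2 (by positivity)).ne'

theorem spaceTest_le_one {s : ℝ} (hs : 0 < s) (R K : ℝ) (x : Space n) : spaceTest s R K x ≤ 1 := by
  refine Real.rpow_le_one_of_one_le_of_nonpos (Real.one_le_sqrt.2 ?_) ?_
  · have : 0 ≤ ‖(R * K)⁻¹ • x‖ ^ 2 := by positivity
    linarith
  · have : (0 : ℝ) ≤ n := Nat.cast_nonneg _
    linarith

theorem spaceTest_mono {s : ℝ} (hs : 0 < s) {R R' K : ℝ} (hR : 0 < R) (hRR : R ≤ R') (hK : 0 < K)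
    (x : Space n) : spaceTest s R K x ≤ spaceTest s R' K x := by
  have : (0 : ℝ) ≤ n := Nat.cast_nonneg _
  have hR' : 0 < R' := hR.trans_le hRR
  refine Real.rpow_le_rpow_of_nonpos (Real.sqrt_pos.2 (by positivity)) ?_ (by linarith)
  rw [norm_smul, norm_smul, Real.norm_of_nonneg (by positivity),
    Real.norm_of_nonneg (by positivity)]
  gcongr

theorem integrable_spaceTest_one {s : ℝ} (hs : 0 < s) :
    Integrable (bracketPow ((n : ℝ) + 2 * s) : Space n → ℝ) := by
  have h := integrable_rpow_neg_one_add_norm_sq (E := Space n) (μ := volume)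
    (r := (n : ℝ) + 2 * s) (by rw [finrank_euclideanSpace_fin]; linarith)
  refine h.congr (.of_forall fun x => ?_)
  simp only [bracketPow]
  rw [Real.sqrt_eq_rpow, ← Real.rpow_mul (by positivity)]
  congr 1; ring

theorem integrable_spaceTest {s : ℝ} (hs : 0 < s) {R K : ℝ} (hRK : 0 < R * K) :
    Integrable (spaceTest s R K : Space n → ℝ) := by
  rw [show (spaceTest s R K : Space n → ℝ) = _ from funext (spaceTest_eq s R K)]
  exact (integrable_spaceTest_one hs).comp_smul (inv_pos.2 hRK).ne'

theorem integral_spaceTest (s : ℝ) {R K : ℝ} (hRK : 0 < R * K) :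
    ∫ x : Space n, spaceTest s R K x
      = (R * K) ^ n * ∫ x : Space n, bracketPow ((n : ℝ) + 2 * s) x := by
  simp only [spaceTest_eq]
  rw [Measure.integral_comp_smul, finrank_euclideanSpace_fin, inv_pow, inv_inv,
    abs_of_pos (by positivity), smul_eq_mul]

end

/-! ### Derivatives of the time cutoff -/

section

/-- Landau's inequality on a half-line. -/
theorem sq_deriv_le_of_bounds {f : ℝ → ℝ} (hf : ContDiff ℝ ∞ f) {t a c : ℝ}
    (ha : ∀ x, t ≤ x → |f x| ≤ a) (hc : ∀ x, t ≤ x → |deriv (deriv f) x| ≤ c)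
    {x : ℝ} (hx : t ≤ x) : |deriv f x| ^ 2 ≤ 8 * a * c := by
  have hd : Differentiable ℝ f := hf.differentiable (by simp)
  have hd' : Differentiable ℝ (deriv f) :=
    (contDiff_infty_iff_deriv.1 hf).2.differentiable (by simp)
  have ha0 : 0 ≤ a := (abs_nonneg _).trans (ha x hx)
  have hc0 : 0 ≤ c := (abs_nonneg _).trans (hc x hx)
  have key : ∀ h : ℝ, 0 < h → |deriv f x| ≤ 2 * a / h + c * h := by
    intro h hh
    obtain ⟨y, hy, hy'⟩ := exists_deriv_eq_slope f (show x < x + h by linarith)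
      hd.continuous.continuousOn hd.differentiableOn
    have h1 : |deriv f y| ≤ 2 * a / h := by
      rw [hy', abs_div, add_sub_cancel_left, abs_of_pos hh]
      gcongr
      have := abs_sub (f (x + h)) (f x)
      linarith [ha x hx, ha (x + h) (by linarith)]
    obtain ⟨z, hz, hz'⟩ := exists_deriv_eq_slope (deriv f) hy.1
      hd'.continuous.continuousOn hd'.differentiableOn
    have hyx : 0 < y - x := by linarith [hy.1]
    have h2 : |deriv f y - deriv f x| ≤ c * h := by
      have := hc z (by linarith [hz.1])
      rw [hz', abs_div, abs_of_pos hyx, div_le_iff₀ hyx] at this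
      refine this.trans ?_
      gcongr
      linarith [hy.2]
    have h3 : |deriv f x| ≤ |deriv f y| + |deriv f y - deriv f x| := by
      have := abs_sub (deriv f y) (deriv f y - deriv f x)
      simpa using this
    linarith
  set y := |deriv f x| with hy
  rcases (abs_nonneg (deriv f x)).eq_or_lt with h0 | h0
  · rw [hy, ← h0, zero_pow two_ne_zero]; positivity
  rcases hc0.eq_or_lt with hc1 | hc1
  · exfalso
    -- without a second-order term a long step makes the slope arbitrarily small
    have := key ((4 * a + 1) / y) (by positivity)
    rw [← hc1, zero_mul, add_zero, div_div_eq_mul_div, le_div_iff₀ (by positivity)] at this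
    nlinarith
  · -- the choice of `h` that balances the second term against half of the left side
    have := key (y / (2 * c)) (by positivity)
    have e : 2 * a / (y / (2 * c)) + c * (y / (2 * c)) = 4 * a * c / y + y / 2 := by
      field_simp; ring
    rw [e] at this
    have h4 : y / 2 ≤ 4 * a * c / y := by linarith
    rw [le_div_iff₀ h0] at h4
    nlinarith

/-- Iterated Landau inequality: a bound `a` of `|f|` on a half-line gives a bound of `|f'|` by
`C a^{m/(m+1)}` there, with `C` independent of the half-line. In the induction step the bound of
`f''` by a power of `sup |f'|` is fed into Landau's inequality. -/
theorem exists_deriv_bound_rpow (m : ℕ) : ∀ {f : ℝ → ℝ}, ContDiff ℝ ∞ f →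
    (∀ k, ∃ M, ∀ x, |iteratedDeriv k f x| ≤ M) →
    ∃ C, 0 ≤ C ∧ ∀ t a : ℝ, (∀ x, t ≤ x → |f x| ≤ a) →
      ∀ x, t ≤ x → |deriv f x| ≤ C * a ^ ((m : ℝ) / (m + 1)) := by
  induction m with
  | zero =>
    intro f hf hb
    obtain ⟨M, hM⟩ := hb 1
    refine ⟨M, (abs_nonneg _).trans (hM 0), fun t a _ x _ => ?_⟩
    simpa using hM x
  | succ m ih =>
    intro f hf hb
    obtain ⟨C, hC0, hC⟩ := ih (f := deriv f) (contDiff_infty_iff_deriv.1 hf).2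
      (fun k => by
        obtain ⟨M, hM⟩ := hb (k + 1)
        exact ⟨M, fun x => by rw [← iteratedDeriv_succ']; exact hM x⟩)
    obtain ⟨M, hM⟩ := hb 1
    rw [iteratedDeriv_one] at hM
    refine ⟨(8 * C) ^ (((m + 1 : ℕ) : ℝ) / ((m + 1 : ℕ) + 1)), by positivity, fun t a ha x hx => ?_⟩
    have ha0 : 0 ≤ a := (abs_nonneg _).trans (ha x hx)
    -- `b` is the supremum of `|f'|` over the half-line
    set b : ℝ := ⨆ y : Ici t, |deriv f y| with hbdef
    have hbdd : BddAbove (range fun y : Ici t => |deriv f y|) :=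
      ⟨M, by rintro _ ⟨y, rfl⟩; exact hM y⟩
    have hle : ∀ y, t ≤ y → |deriv f y| ≤ b := fun y hy => le_ciSup hbdd (⟨y, hy⟩ : Ici t)
    have hb0 : 0 ≤ b := (abs_nonneg _).trans (hle x hx)
    rw [← Real.mul_rpow (by positivity) ha0]
    refine (hle x hx).trans ?_
    have h2 := hC t b hle
    have h3 : b ^ 2 ≤ 8 * a * (C * b ^ ((m : ℝ) / (m + 1))) := by
      have : b ≤ √(8 * a * (C * b ^ ((m : ℝ) / (m + 1)))) := by
        have : Nonempty (Ici t) := ⟨⟨t, mem_Ici.2 le_rfl⟩⟩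
        refine ciSup_le fun y => Real.le_sqrt_of_sq_le ?_
        exact sq_deriv_le_of_bounds hf ha h2 y.2
      calc b ^ 2 ≤ √(8 * a * (C * b ^ ((m : ℝ) / (m + 1)))) ^ 2 := by gcongr
        _ = _ := Real.sq_sqrt (by positivity)
    rcases hb0.eq_or_lt with h0 | h0
    · rw [← h0]; positivity
    have h4 : b ^ (((m : ℝ) + 2) / (m + 1)) ≤ 8 * C * a := by
      have e : b ^ 2 = b ^ (((m : ℝ) + 2) / (m + 1)) * b ^ ((m : ℝ) / (m + 1)) := by
        rw [← Real.rpow_add h0, ← Real.rpow_natCast]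
        congr 1; field_simp; push_cast; ring
      rw [e] at h3
      refine le_of_mul_le_mul_right (h3.trans_eq ?_) (Real.rpow_pos_of_pos h0 ((m : ℝ) / (m + 1)))
      ring
    calc b = (b ^ (((m : ℝ) + 2) / (m + 1))) ^ (((m + 1 : ℕ) : ℝ) / ((m + 1 : ℕ) + 1)) := by
          rw [← Real.rpow_mul hb0]
          have : ((m : ℝ) + 2) / (m + 1) * (((m + 1 : ℕ) : ℝ) / ((m + 1 : ℕ) + 1)) = 1 := by
            push_cast; field_simp; ring
          rw [this, Real.rpow_one]
      _ ≤ _ := by gcongr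

namespace IsTimeCutoff
variable {ζ : ℝ → ℝ}

theorem nonneg (hζ : IsTimeCutoff ζ) (t : ℝ) : 0 ≤ ζ t := by
  rw [← hζ.eq_zero (max t 1) (le_max_right _ _)]
  exact hζ.antitone (le_max_left _ _)

theorem le_one (hζ : IsTimeCutoff ζ) (t : ℝ) : ζ t ≤ 1 := by
  rw [← hζ.eq_one (min t (1 / 2)) (min_le_right _ _)]
  exact hζ.antitone (min_le_left _ _)

theorem iteratedDeriv_eq_zero (hζ : IsTimeCutoff ζ) {k : ℕ} (hk : k ≠ 0) {t : ℝ}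
    (ht : t ∉ Icc (1 / 2 : ℝ) 1) : iteratedDeriv k ζ t = 0 := by
  have : ∃ c : ℝ, ζ =ᶠ[nhds t] fun _ => c := by
    rw [mem_Icc, not_and_or, not_le, not_le] at ht
    rcases ht with h | h
    · exact ⟨1, by filter_upwards [Iio_mem_nhds h] with x hx using hζ.eq_one x (le_of_lt hx)⟩
    · exact ⟨0, by filter_upwards [Ioi_mem_nhds h] with x hx using hζ.eq_zero x (le_of_lt hx)⟩
  obtain ⟨c, hc⟩ := this
  rw [hc.iteratedDeriv_eq, iteratedDeriv_const, if_neg hk]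

theorem exists_iteratedDeriv_le (hζ : IsTimeCutoff ζ) (k : ℕ) :
    ∃ M, ∀ x, |iteratedDeriv k ζ x| ≤ M := by
  rcases eq_or_ne k 0 with rfl | hk
  · exact ⟨1, fun x => by simpa [abs_of_nonneg (hζ.nonneg x)] using hζ.le_one x⟩
  obtain ⟨M, hM⟩ := (isCompact_Icc (a := (1 / 2 : ℝ)) (b := 1)).exists_bound_of_continuousOn
    (hζ.smooth.continuous_iteratedDeriv k (by exact_mod_cast le_top)).continuousOn
  refine ⟨max M 0, fun x => ?_⟩
  by_cases hx : x ∈ Icc (1 / 2 : ℝ) 1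
  · exact (hM x hx).trans (le_max_left _ _)
  · rw [hζ.iteratedDeriv_eq_zero hk hx]; simp

/-- The bound of `exists_deriv_bound_rpow`, passed from each derivative to the next one. By
monotonicity `ζ t` bounds `ζ` on all of `[t, ∞)`, which starts the induction. -/
theorem exists_iteratedDeriv_le_rpow (hζ : IsTimeCutoff ζ) (m k : ℕ) :
    ∃ C, 0 ≤ C ∧ ∀ t x : ℝ, t ≤ x →
      |iteratedDeriv k ζ x| ≤ C * ζ t ^ (((m : ℝ) / (m + 1)) ^ k) := by
  induction k with
  | zero =>
    refine ⟨1, zero_le_one, fun t x hx => ?_⟩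
    simpa [abs_of_nonneg (hζ.nonneg x)] using hζ.antitone hx
  | succ k ih =>
    obtain ⟨C, hC0, hC⟩ := ih
    obtain ⟨C', hC0', hC'⟩ := exists_deriv_bound_rpow m (f := iteratedDeriv k ζ)
      (by rw [iteratedDeriv_eq_iterate]; exact hζ.smooth.iterate_deriv k)
      (fun j => by
        obtain ⟨M, hM⟩ := hζ.exists_iteratedDeriv_le (j + k)
        refine ⟨M, fun x => ?_⟩
        have := hM x
        rwa [iteratedDeriv_eq_iterate, Function.iterate_add_apply, ← iteratedDeriv_eq_iterate,
          ← iteratedDeriv_eq_iterate] at this)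
    refine ⟨C' * C ^ ((m : ℝ) / (m + 1)), by positivity, fun t x hx => ?_⟩
    rw [iteratedDeriv_succ]
    refine (hC' t _ (hC t) x hx).trans_eq ?_
    have := hζ.nonneg t
    rw [Real.mul_rpow hC0 (by positivity), ← Real.rpow_mul this, mul_assoc, pow_succ]

/-- The derivatives of a monotone cutoff are dominated by any of its powers of exponent less than
one, because the cutoff bounds itself on half-lines. -/
theorem exists_iteratedDeriv_le_rpow_inv (hζ : IsTimeCutoff ζ) {p : ℝ} (hp : 1 < p) (k : ℕ) :
    ∃ C, 0 ≤ C ∧ ∀ t, |iteratedDeriv k ζ t| ≤ C * ζ t ^ (1 / p) := by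
  have hlim : Filter.Tendsto (fun m : ℕ => ((m : ℝ) / (m + 1)) ^ k) Filter.atTop (nhds 1) := by
    simpa using (tendsto_natCast_div_add_atTop (1 : ℝ)).pow k
  have hp1 : 1 / p < 1 := by rw [div_lt_one (by linarith)]; exact hp
  obtain ⟨m, hm⟩ := (hlim.eventually (lt_mem_nhds hp1)).exists
  obtain ⟨C, hC0, hC⟩ := hζ.exists_iteratedDeriv_le_rpow m k
  refine ⟨C, hC0, fun t => (hC t t le_rfl).trans ?_⟩
  have hp0 : 0 < 1 / p := by positivity
  rcases (hζ.nonneg t).eq_or_lt with h | h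
  · rw [← h, Real.zero_rpow (hp0.trans hm).ne', Real.zero_rpow hp0.ne']
  · gcongr ?_ * ?_
    exact Real.rpow_le_rpow_of_exponent_ge h (hζ.le_one t) hm.le

end IsTimeCutoff
end

/-! ### The adjoint operator on the test functions -/

section
variable {n : ℕ}

/-- The times at which the derivatives of the cutoff `ζ_R` may be nonzero. -/
def timeLayer (σ R : ℝ) : Set ℝ := {t | R ^ (-(2 * σ / 3)) * t ∈ Icc (1 / 2 : ℝ) 1}

/-- The times at which the cutoff `ζ_R` may be nonzero. -/
def timePast (σ R : ℝ) : Set ℝ := {t | R ^ (-(2 * σ / 3)) * t ≤ 1}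

theorem timeLayer_subset (σ R : ℝ) : timeLayer σ R ⊆ timePast σ R := fun _ h => h.2

theorem measurableSet_timeLayer (σ R : ℝ) : MeasurableSet (timeLayer σ R) :=
  (measurable_const_mul _) measurableSet_Icc

theorem measurableSet_timePast (σ R : ℝ) : MeasurableSet (timePast σ R) :=
  (measurable_const_mul _) measurableSet_Iic

theorem adjointOp_eq {σ η : ℝ} {ζ : ℝ → ℝ} (hζ : IsTimeCutoff ζ) (f : Space n → ℝ) (R t : ℝ)
    (x : Space n) :
    adjointOp σ η (fun t x => f x * timeTest σ ζ R t) t x =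
      - (f x * ((R ^ (-(2 * σ / 3))) ^ 3 * iteratedDeriv 3 ζ (R ^ (-(2 * σ / 3)) * t)))
      + fracLaplacian σ f x * ζ (R ^ (-(2 * σ / 3)) * t)
      + η * (fracLaplacian (σ / 3) f x *
          ((R ^ (-(2 * σ / 3))) ^ 2 * iteratedDeriv 2 ζ (R ^ (-(2 * σ / 3)) * t)))
      - η * (fracLaplacian (2 * σ / 3) f x *
          ((R ^ (-(2 * σ / 3))) ^ 1 * iteratedDeriv 1 ζ (R ^ (-(2 * σ / 3)) * t))) := by
  have h : ∀ (k : ℕ) (y : Space n), iteratedDeriv k (fun τ => f y * timeTest σ ζ R τ) t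
      = f y * ((R ^ (-(2 * σ / 3))) ^ k * iteratedDeriv k ζ (R ^ (-(2 * σ / 3)) * t)) := by
    intro k y
    have hk : ContDiff ℝ k ζ := hζ.smooth.of_le (by exact_mod_cast le_top)
    rw [iteratedDeriv_const_mul_field]
    congr 1
    exact congrFun (iteratedDeriv_comp_const_mul hk (R ^ (-(2 * σ / 3)))) t
  unfold adjointOp
  simp only [← iteratedDeriv_one, h]
  rw [fracLaplacian_const_mul, fracLaplacian_const_mul]
  congr 3
  exact fracLaplacian_const_mul _ _ _ _

/-- Pointwise bound of the adjoint operator on the test functions. The terms with a time derivative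
live on `timeLayer`; the remaining one carries a negative power of `K`. -/
theorem exists_adjointOp_le {σ η p s : ℝ} (hσ : 0 < σ) (hη : 0 ≤ η) (hp : 1 < p)
    (hs : AdmissibleWeight σ s) {ζ : ℝ → ℝ} (hζ : IsTimeCutoff ζ) :
    ∃ C, 0 ≤ C ∧ ∀ R K : ℝ, 0 < R → 1 ≤ K → ∀ (t : ℝ) (x : Space n),
      |adjointOp σ η (fun t x => spaceTest s R K x * timeTest σ ζ R t) t x| ≤
        spaceTest s R K x * (timeTest σ ζ R t ^ (1 / p) * (C * R ^ (-(2 * σ)) *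
          ((timeLayer σ R).indicator 1 t + K ^ (-(2 * σ)) * (timePast σ R).indicator 1 t))) := by
  obtain ⟨A₁, hA₁, h₁⟩ := exists_fracLaplacian_spaceTest_le (n := n) hs.1
    (hs.lt hσ (γ := σ / 3) (by simp))
  obtain ⟨A₂, hA₂, h₂⟩ := exists_fracLaplacian_spaceTest_le (n := n) hs.1
    (hs.lt hσ (γ := 2 * σ / 3) (by simp))
  obtain ⟨A₃, hA₃, h₃⟩ := exists_fracLaplacian_spaceTest_le (n := n) hs.1
    (hs.lt hσ (γ := σ) (by simp))
  obtain ⟨B₁, hB₁, b₁⟩ := hζ.exists_iteratedDeriv_le_rpow_inv hp 1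
  obtain ⟨B₂, hB₂, b₂⟩ := hζ.exists_iteratedDeriv_le_rpow_inv hp 2
  obtain ⟨B₃, hB₃, b₃⟩ := hζ.exists_iteratedDeriv_le_rpow_inv hp 3
  set C := B₃ + A₃ + η * (A₁ * B₂) + η * (A₂ * B₁) with hC
  have hC0 : 0 ≤ C := by positivity
  refine ⟨C, hC0, fun R K hR hK t x => ?_⟩
  have hK0 : 0 < K := one_pos.trans_le hK
  have hRK : 0 < R * K := mul_pos hR hK0
  set c := R ^ (-(2 * σ / 3)) with hc
  have hc0 : 0 < c := Real.rpow_pos_of_pos hR _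
  set φ := spaceTest s R K x with hφ
  have hφ0 : 0 < φ := spaceTest_pos s R K x
  set z := ζ (c * t) ^ (1 / p) with hz
  have hz0 : 0 ≤ z := Real.rpow_nonneg (hζ.nonneg _) _
  have hK1 : ∀ γ : ℝ, 0 ≤ γ → (R * K) ^ (-(2 * γ)) ≤ R ^ (-(2 * γ)) := fun γ hγ =>
    Real.rpow_le_rpow_of_nonpos hR (le_mul_of_one_le_right hR.le hK) (by linarith)
  have e3 : c ^ 3 = R ^ (-(2 * σ)) := by
    rw [hc, ← Real.rpow_natCast, ← Real.rpow_mul hR.le]; congr 1; push_cast; ring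
  have e2 : R ^ (-(2 * (σ / 3))) * c ^ 2 = R ^ (-(2 * σ)) := by
    rw [hc, ← Real.rpow_natCast, ← Real.rpow_mul hR.le, ← Real.rpow_add hR]
    congr 1; push_cast; ring
  have e1 : R ^ (-(2 * (2 * σ / 3))) * c ^ 1 = R ^ (-(2 * σ)) := by
    rw [hc, ← Real.rpow_natCast, ← Real.rpow_mul hR.le, ← Real.rpow_add hR]
    congr 1; push_cast; ring
  set ρ := R ^ (-(2 * σ)) with hρ
  have hρ0 : 0 < ρ := Real.rpow_pos_of_pos hR _
  set l : ℝ := (timeLayer σ R).indicator 1 t with hl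
  set r : ℝ := (timePast σ R).indicator 1 t with hr
  have hl0 : 0 ≤ l := indicator_nonneg (fun _ _ => zero_le_one) _
  have hr0 : 0 ≤ r := indicator_nonneg (fun _ _ => zero_le_one) _
  have hder : ∀ {k : ℕ} {B : ℝ}, k ≠ 0 → (∀ t, |iteratedDeriv k ζ t| ≤ B * ζ t ^ (1 / p)) →
      |iteratedDeriv k ζ (c * t)| ≤ B * z * l := by
    intro k B hk hB
    by_cases ht : t ∈ timeLayer σ R
    · rw [hl, indicator_of_mem ht, Pi.one_apply, mul_one]; exact hB (c * t)
    · rw [hζ.iteratedDeriv_eq_zero hk ht, hl, indicator_of_notMem ht]; simp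
  have hzeta : |ζ (c * t)| ≤ z * r := by
    rw [abs_of_nonneg (hζ.nonneg _)]
    by_cases ht : t ∈ timePast σ R
    · rw [hr, indicator_of_mem ht, Pi.one_apply, mul_one, hz]
      exact Real.self_le_rpow_of_le_one (hζ.nonneg _) (hζ.le_one _)
        ((div_le_one (by linarith)).2 hp.le)
    · have : 1 ≤ c * t := (not_le.1 ht).le
      rw [hζ.eq_zero _ this]; positivity
  have T3 : |φ * (c ^ 3 * iteratedDeriv 3 ζ (c * t))| ≤ φ * (z * (B₃ * ρ * l)) := by
    rw [abs_mul, abs_mul, abs_of_pos hφ0, abs_of_pos (by positivity : 0 < c ^ 3), e3]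
    calc _ ≤ φ * (ρ * (B₃ * z * l)) := by gcongr; exact hder (by norm_num) b₃
      _ = _ := by ring
  have T0 : |fracLaplacian σ (spaceTest s R K) x * ζ (c * t)|
      ≤ φ * (z * (A₃ * ρ * (K ^ (-(2 * σ)) * r))) := by
    rw [abs_mul]
    calc _ ≤ (A₃ * (R * K) ^ (-(2 * σ)) * φ) * (z * r) := by gcongr; exact h₃ R K hRK x
      _ = _ := by rw [Real.mul_rpow hR.le hK0.le]; ring
  have T2 : |η * (fracLaplacian (σ / 3) (spaceTest s R K) x * (c ^ 2 * iteratedDeriv 2 ζ (c * t)))|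
      ≤ φ * (z * (η * (A₁ * B₂) * ρ * l)) := by
    rw [abs_mul, abs_mul, abs_mul, abs_of_nonneg hη, abs_of_pos (by positivity : 0 < c ^ 2)]
    calc _ ≤ η * ((A₁ * R ^ (-(2 * (σ / 3))) * φ) * (c ^ 2 * (B₂ * z * l))) := by
          gcongr
          · exact (h₁ R K hRK x).trans (mul_le_mul_of_nonneg_right
              (mul_le_mul_of_nonneg_left (hK1 _ (by positivity)) hA₁) hφ0.le)
          · exact hder (by norm_num) b₂
      _ = η * (A₁ * B₂) * φ * z * l * (R ^ (-(2 * (σ / 3))) * c ^ 2) := by ring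
      _ = _ := by rw [e2]; ring
  have T1 : |η * (fracLaplacian (2 * σ / 3) (spaceTest s R K) x *
      (c ^ 1 * iteratedDeriv 1 ζ (c * t)))| ≤ φ * (z * (η * (A₂ * B₁) * ρ * l)) := by
    rw [abs_mul, abs_mul, abs_mul, abs_of_nonneg hη, abs_of_pos (by positivity : 0 < c ^ 1)]
    calc _ ≤ η * ((A₂ * R ^ (-(2 * (2 * σ / 3))) * φ) * (c ^ 1 * (B₁ * z * l))) := by
          gcongr
          · exact (h₂ R K hRK x).trans (mul_le_mul_of_nonneg_right
              (mul_le_mul_of_nonneg_left (hK1 _ (by positivity)) hA₂) hφ0.le)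
          · exact hder (by norm_num) b₁
      _ = η * (A₂ * B₁) * φ * z * l * (R ^ (-(2 * (2 * σ / 3))) * c ^ 1) := by ring
      _ = _ := by rw [e1]; ring
  rw [adjointOp_eq hζ]
  refine (abs_sub _ _).trans ((add_le_add ((abs_add_le _ _).trans (add_le_add
    ((abs_add_le _ _).trans (add_le_add ((abs_neg _).le.trans T3) T0)) T2)) T1).trans ?_)
  have hKp : 0 < K ^ (-(2 * σ)) := Real.rpow_pos_of_pos hK0 _
  have hzz : timeTest σ ζ R t ^ (1 / p) = z := rfl
  rw [hzz]
  have hle : B₃ * ρ * l + A₃ * ρ * (K ^ (-(2 * σ)) * r) + η * (A₁ * B₂) * ρ * l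
      + η * (A₂ * B₁) * ρ * l ≤ C * ρ * (l + K ^ (-(2 * σ)) * r) := by
    have hm : 0 ≤ A₃ * ρ * l := by positivity
    have hm' : 0 ≤ (B₃ + η * (A₁ * B₂) + η * (A₂ * B₁)) * ρ * (K ^ (-(2 * σ)) * r) := by positivity
    rw [hC]
    linear_combination hm + hm'
  calc _ = φ * (z * (B₃ * ρ * l + A₃ * ρ * (K ^ (-(2 * σ)) * r) + η * (A₁ * B₂) * ρ * l
      + η * (A₂ * B₁) * ρ * l)) := by ring
    _ ≤ _ := by gcongr

/-- Young's inequality with a free parameter. -/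
theorem mul_le_young {p : ℝ} (hp : 1 < p) {a b μ : ℝ} (ha : 0 ≤ a) (hb : 0 ≤ b) (hμ : 0 < μ) :
    a * b ≤ μ * a ^ p + μ ^ (-(1 / (p - 1))) * b ^ (p / (p - 1)) := by
  have hq : p.HolderConjugate (p / (p - 1)) := Real.HolderConjugate.conjExponent hp
  have hp0 : 0 < p := by linarith
  have hp1 : 0 < p - 1 := by linarith
  have h := Real.young_inequality_of_nonneg (a := μ ^ (1 / p) * a) (b := μ ^ (-(1 / p)) * b)
    (by positivity) (by positivity) hq
  have e1 : (μ ^ (1 / p) * a) * (μ ^ (-(1 / p)) * b) = a * b := by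
    have : μ ^ (1 / p) * μ ^ (-(1 / p)) = 1 := by rw [← Real.rpow_add hμ]; simp
    calc _ = (μ ^ (1 / p) * μ ^ (-(1 / p))) * (a * b) := by ring
      _ = _ := by rw [this, one_mul]
  have e2 : (μ ^ (1 / p) * a) ^ p = μ * a ^ p := by
    rw [Real.mul_rpow (by positivity) ha, ← Real.rpow_mul hμ.le, one_div_mul_cancel hp0.ne',
      Real.rpow_one]
  have e3 : (μ ^ (-(1 / p)) * b) ^ (p / (p - 1)) = μ ^ (-(1 / (p - 1))) * b ^ (p / (p - 1)) := by
    rw [Real.mul_rpow (by positivity) hb, ← Real.rpow_mul hμ.le]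
    congr 2; field_simp
  rw [e1, e2, e3] at h
  refine h.trans (add_le_add (div_le_self (by positivity) hp.le) (div_le_self (by positivity) ?_))
  exact hq.symm.lt.le

/-- Subcriticality or criticality of `p`, as a sign of the exponent of `R` in the test function
method. -/
theorem exponent_nonpos {σ p : ℝ} (hσ : 0 < σ) (hp : 1 < p) (hpc : (p : EReal) ≤ pCrit n σ) :
    (n : ℝ) + 2 * σ / 3 - 2 * σ * (p / (p - 1)) ≤ 0 := by
  have hp1 : 0 < p - 1 := by linarith
  have key : ((n : ℝ) + 2 * σ / 3) * (p - 1) ≤ 2 * σ * p := by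
    unfold pCrit at hpc
    split_ifs at hpc with h
    · nlinarith
    · push Not at h
      have h' : p ≤ 1 + 6 * σ / (3 * (n : ℝ) - 4 * σ) := by exact_mod_cast hpc
      have hd : 0 < 3 * (n : ℝ) - 4 * σ := by linarith
      have : (p - 1) * (3 * (n : ℝ) - 4 * σ) ≤ 6 * σ := by
        rw [← le_div_iff₀ hd]; linarith
      nlinarith
  have : (n : ℝ) + 2 * σ / 3 ≤ 2 * σ * p / (p - 1) := (le_div_iff₀ hp1).2 key
  rw [← mul_div_assoc]; linarith

theorem setIntegral_timePast {σ R : ℝ} (hR : 0 < R) :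
    ∫ t in Ioi (0 : ℝ), (timePast σ R).indicator (1 : ℝ → ℝ) t = R ^ (2 * σ / 3) := by
  have hc : 0 < R ^ (2 * σ / 3) := Real.rpow_pos_of_pos hR _
  have e : Ioi (0 : ℝ) ∩ timePast σ R = Ioc 0 (R ^ (2 * σ / 3)) := by
    ext t
    simp only [timePast, mem_inter_iff, mem_Ioi, mem_ofPred_eq, mem_Ioc]
    rw [Real.rpow_neg hR.le, inv_mul_le_iff₀ hc, mul_one]
  rw [setIntegral_indicator (measurableSet_timePast σ R), e]
  simp [hc.le]

theorem integrableOn_timePast {σ R : ℝ} (hR : 0 < R) :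
    IntegrableOn ((timePast σ R).indicator (1 : ℝ → ℝ)) (Ioi 0) := by
  -- the integral of a non-integrable function would be zero
  refine Integrable.of_integral_ne_zero ?_
  rw [setIntegral_timePast hR]
  exact (Real.rpow_pos_of_pos hR _).ne'

end

/-! ### The test function estimate -/

section
variable {n : ℕ}

/-- The initial data term of the weak formulation, without the factor `ε`. -/
noncomputable def dataTerm (σ η s : ℝ) (u₀ u₁ u₂ : Space n → ℝ) (R K : ℝ) : ℝ :=
  ∫ x : Space n, (η * u₀ x * fracLaplacian (2 * σ / 3) (spaceTest s R K) x
    + η * u₁ x * fracLaplacian (σ / 3) (spaceTest s R K) x + u₂ x * spaceTest s R K x)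

/-- The nonlinear density of the weak formulation. -/
noncomputable def massDensity (σ p s : ℝ) (ζ : ℝ → ℝ) (u : ℝ → Space n → ℝ) (R K : ℝ)
    (z : ℝ × Space n) : ℝ :=
  |u z.1 z.2| ^ p * (spaceTest s R K z.2 * timeTest σ ζ R z.1)

/-- The nonlinear term of the weak formulation. -/
noncomputable def mass (σ p s : ℝ) (ζ : ℝ → ℝ) (u : ℝ → Space n → ℝ) (R K : ℝ) : ℝ :=
  ∫ z in (Ioi (0 : ℝ)) ×ˢ (univ : Set (Space n)), massDensity σ p s ζ u R K z

/-- The part of the nonlinear term carried by the time layer on which `ζ_R` varies. -/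
noncomputable def layerMass (σ p s : ℝ) (ζ : ℝ → ℝ) (u : ℝ → Space n → ℝ) (R K : ℝ) : ℝ :=
  ∫ z in (Ioi (0 : ℝ)) ×ˢ (univ : Set (Space n)),
    (timeLayer σ R ×ˢ univ).indicator (massDensity σ p s ζ u R K) z

theorem massDensity_nonneg {σ p s : ℝ} {ζ : ℝ → ℝ} (hζ : IsTimeCutoff ζ) (u : ℝ → Space n → ℝ)
    (R K : ℝ) (z : ℝ × Space n) : 0 ≤ massDensity σ p s ζ u R K z :=
  mul_nonneg (by positivity) (mul_nonneg (spaceTest_pos _ _ _ _).le (hζ.nonneg _))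

theorem measurableSet_layer (σ R : ℝ) :
    MeasurableSet (timeLayer σ R ×ˢ (univ : Set (Space n))) :=
  (measurableSet_timeLayer σ R).prod .univ

theorem layerMass_le_mass {σ p s : ℝ} {ζ : ℝ → ℝ} (hζ : IsTimeCutoff ζ) {u : ℝ → Space n → ℝ}
    {R K : ℝ} (hu : IntegrableOn (massDensity σ p s ζ u R K) (Ioi 0 ×ˢ univ)) :
    layerMass σ p s ζ u R K ≤ mass σ p s ζ u R K := by
  refine integral_mono (hu.indicator (measurableSet_layer σ R)) hu fun z => ?_
  exact indicator_le_self' (fun _ _ => massDensity_nonneg hζ u R K _) z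

/-- Only the datum `u₂` survives for large `R`: the other two are paired with functions of size
`(R K)^{-2γ}`, `γ > 0`. -/
theorem tendsto_dataTerm {σ η s : ℝ} (hσ : 0 < σ) (hη : 0 ≤ η) (hs : AdmissibleWeight σ s)
    {u₀ u₁ u₂ : Space n → ℝ} (hu₀ : Integrable u₀) (hu₁ : Integrable u₁) (hu₂ : Integrable u₂)
    {K : ℝ} (hK : 1 ≤ K) :
    Filter.Tendsto (fun R => dataTerm σ η s u₀ u₁ u₂ R K) Filter.atTop (nhds (∫ x, u₂ x)) := by
  have l₁ := hs.lt hσ (γ := σ / 3) (by simp)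
  have l₂ := hs.lt hσ (γ := 2 * σ / 3) (by simp)
  obtain ⟨A₁, hA₁, h₁⟩ := exists_fracLaplacian_spaceTest_le (n := n) hs.1 l₁
  obtain ⟨A₂, hA₂, h₂⟩ := exists_fracLaplacian_spaceTest_le (n := n) hs.1 l₂
  have hK0 : 0 < K := one_pos.trans_le hK
  have b : ∀ {γ A : ℝ}, 0 < γ → 0 ≤ A → (∀ R K : ℝ, 0 < R * K → ∀ x : Space n,
      |fracLaplacian γ (spaceTest s R K) x| ≤ A * (R * K) ^ (-(2 * γ)) * spaceTest s R K x) →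
      ∀ R : ℝ, 1 ≤ R → ∀ x : Space n,
        |fracLaplacian γ (spaceTest s R K) x| ≤ A * (R * K) ^ (-(2 * γ)) := by
    intro γ A hγ hA h R hR x
    have hRK : 0 < R * K := mul_pos (one_pos.trans_le hR) hK0
    exact (h R K hRK x).trans (mul_le_of_le_one_right (by positivity) (spaceTest_le_one hs.1 R K x))
  have hRK1 : ∀ R : ℝ, 1 ≤ R → 1 ≤ R * K := fun R hR => one_le_mul_of_one_le_of_one_le hR hK
  have hb1 : ∀ {γ : ℝ}, 0 < γ → ∀ R : ℝ, 1 ≤ R → (R * K) ^ (-(2 * γ)) ≤ 1 := fun hγ R hR =>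
    Real.rpow_le_one_of_one_le_of_nonpos (hRK1 R hR) (by linarith)
  have hRK : Filter.Tendsto (fun R : ℝ => R * K) Filter.atTop Filter.atTop :=
    Filter.tendsto_id.atTop_mul_const hK0
  have lim : ∀ {γ A : ℝ}, 0 < γ → 0 ≤ A → (∀ R K : ℝ, 0 < R * K → ∀ x : Space n,
      |fracLaplacian γ (spaceTest s R K) x| ≤ A * (R * K) ^ (-(2 * γ)) * spaceTest s R K x) →
      ∀ x : Space n, Filter.Tendsto (fun R => fracLaplacian γ (spaceTest s R K) x) Filter.atTop
        (nhds 0) := by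
    intro γ A hγ hA h x
    have h0 : Filter.Tendsto (fun R : ℝ => A * (R * K) ^ (-(2 * γ))) Filter.atTop (nhds 0) := by
      simpa using ((tendsto_rpow_neg_atTop (by positivity : 0 < 2 * γ)).comp hRK).const_mul A
    refine squeeze_zero_norm' ?_ h0
    filter_upwards [Filter.eventually_ge_atTop 1] with R hR using b hγ hA h R hR x
  have limφ : ∀ x : Space n, Filter.Tendsto (fun R => spaceTest s R K x) Filter.atTop (nhds 1) := by
    intro x
    have hc : Continuous (fun c : ℝ => bracketPow ((n : ℝ) + 2 * s) (c • x)) := by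
      unfold bracketPow
      exact Continuous.rpow_const (by fun_prop) fun x =>
        Or.inl (Real.sqrt_pos.2 (by positivity)).ne'
    have := (hc.tendsto 0).comp (tendsto_inv_atTop_zero.comp hRK)
    have e : bracketPow ((n : ℝ) + 2 * s) ((0 : ℝ) • x) = 1 := by simp [bracketPow]
    rw [e] at this
    simp only [spaceTest_eq]
    exact this
  have hγ₁ : 0 < σ / 3 := by positivity
  have hγ₂ : 0 < 2 * σ / 3 := by positivity
  refine tendsto_integral_filter_of_dominated_convergence
    (fun x => η * |u₀ x| * A₂ + η * |u₁ x| * A₁ + |u₂ x|) ?_ ?_ ?_ ?_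
  · filter_upwards [Filter.eventually_ge_atTop 1] with R hR
    have hRK : 0 < R * K := mul_pos (one_pos.trans_le hR) hK0
    refine (AEStronglyMeasurable.add ?_ ?_).add ?_
    · exact (hu₀.1.const_mul η).mul
        (continuous_fracLaplacian_spaceTest hs.1 l₂ hRK).aestronglyMeasurable
    · exact (hu₁.1.const_mul η).mul
        (continuous_fracLaplacian_spaceTest hs.1 l₁ hRK).aestronglyMeasurable
    · exact hu₂.1.mul (continuous_spaceTest s R K).aestronglyMeasurable
  · filter_upwards [Filter.eventually_ge_atTop 1] with R hR
    refine .of_forall fun x => ?_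
    have e₁ := (b hγ₁ hA₁ h₁ R hR x).trans (mul_le_of_le_one_right hA₁ (hb1 hγ₁ R hR))
    have e₂ := (b hγ₂ hA₂ h₂ R hR x).trans (mul_le_of_le_one_right hA₂ (hb1 hγ₂ R hR))
    have e₃ : |spaceTest s R K x| ≤ 1 := by
      rw [abs_of_pos (spaceTest_pos _ _ _ _)]; exact spaceTest_le_one hs.1 R K x
    refine (abs_add_le _ _).trans (add_le_add ((abs_add_le _ _).trans (add_le_add ?_ ?_)) ?_)
    · rw [abs_mul, abs_mul, abs_of_nonneg hη]; gcongr
    · rw [abs_mul, abs_mul, abs_of_nonneg hη]; gcongr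
    · rw [abs_mul]; exact mul_le_of_le_one_right (abs_nonneg _) e₃
  · exact (((hu₀.abs.const_mul η).mul_const A₂).add ((hu₁.abs.const_mul η).mul_const A₁)).add
      hu₂.abs
  · refine .of_forall fun x => ?_
    have := (((lim hγ₂ hA₂ h₂ x).const_mul (η * u₀ x)).add
      ((lim hγ₁ hA₁ h₁ x).const_mul (η * u₁ x))).add ((limφ x).const_mul (u₂ x))
    simpa using this

/-- The basic estimate of the test function method: the linear side of the weak formulation is
absorbed by Young's inequality, with a free parameter `μ` on the time layer. -/
theorem exists_mass_estimate {σ η p s : ℝ} (hσ : 0 < σ) (hη : 0 ≤ η) (hp : 1 < p)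
    (hpc : (p : EReal) ≤ pCrit n σ)
    (hs : AdmissibleWeight σ s) {ζ : ℝ → ℝ} (hζ : IsTimeCutoff ζ) :
    ∃ C, 0 ≤ C ∧ ∀ (ε : ℝ) (u₀ u₁ u₂ : Space n → ℝ) (T : EReal) (u : ℝ → Space n → ℝ),
      IsWeakSolution σ η p ε s ζ u₀ u₁ u₂ T u →
      ∀ R K μ : ℝ, 1 ≤ R → 1 ≤ K → ((R ^ (2 * σ / 3) : ℝ) : EReal) < T → 0 < μ →
      ε * dataTerm σ η s u₀ u₁ u₂ R K + mass σ p s ζ u R K ≤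
        μ * layerMass σ p s ζ u R K + 1 / 4 * mass σ p s ζ u R K
        + C * (μ ^ (-(1 / (p - 1))) * K ^ (n : ℝ) + K ^ ((n : ℝ) - 2 * σ * (p / (p - 1)))) := by
  obtain ⟨A, hA, hadj⟩ := exists_adjointOp_le (n := n) hσ hη hp hs hζ
  set q := p / (p - 1) with hq
  have hp1 : 0 < p - 1 := by linarith
  have hp0 : 0 < p := by linarith
  have hq0 : 0 < q := by positivity
  set Φ : ℝ := ∫ x : Space n, bracketPow ((n : ℝ) + 2 * s) x with hΦ
  have hΦ0 : 0 ≤ Φ := integral_nonneg fun x => Real.rpow_nonneg (Real.sqrt_nonneg _) _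
  set D : ℝ := (1 / 4) ^ (-(1 / (p - 1))) with hD
  have hD0 : 0 < D := by positivity
  refine ⟨A ^ q * Φ * (1 + D), by positivity, fun ε u₀ u₁ u₂ T u hu R K μ hR1 hK1 hT hμ => ?_⟩
  have hR : 0 < R := one_pos.trans_le hR1
  have hK : 0 < K := one_pos.trans_le hK1
  have hRK : 0 < R * K := mul_pos hR hK
  have hm : IntegrableOn (massDensity σ p s ζ u R K) (Ioi 0 ×ˢ univ) :=
    hu.integrable_nonlinear R K hR hK1 hT
  set M := μ ^ (-(1 / (p - 1))) with hM
  have hM0 : 0 < M := by positivity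
  set Q := K ^ (-(2 * σ)) with hQ
  have hQ0 : 0 < Q := by positivity
  set a := A * R ^ (-(2 * σ)) with ha
  have ha0 : 0 ≤ a := by positivity
  set E := (M + D * Q ^ q) * a ^ q with hE
  have hE0 : 0 ≤ E := by positivity
  -- the pointwise form of the estimate
  have hpt : ∀ z : ℝ × Space n,
      u z.1 z.2 * adjointOp σ η (fun t x => spaceTest s R K x * timeTest σ ζ R t) z.1 z.2 ≤
        μ * (timeLayer σ R ×ˢ univ).indicator (massDensity σ p s ζ u R K) z
        + 1 / 4 * massDensity σ p s ζ u R K z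
        + E * ((timePast σ R).indicator 1 z.1 * spaceTest s R K z.2) := by
    rintro ⟨t, x⟩
    simp only
    set φ := spaceTest s R K x with hφ
    have hφ0 : 0 < φ := spaceTest_pos s R K x
    set ξ := timeTest σ ζ R t with hξ
    have hξ0 : 0 ≤ ξ := hζ.nonneg _
    set l : ℝ := (timeLayer σ R).indicator 1 t with hl
    set r : ℝ := (timePast σ R).indicator 1 t with hr
    have hr0 : 0 ≤ r := indicator_nonneg (fun _ _ => zero_le_one) _
    set w := |u t x| * ξ ^ (1 / p) with hw
    have hw0 : 0 ≤ w := by positivity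
    have hwp : φ * w ^ p = massDensity σ p s ζ u R K (t, x) := by
      rw [hw, Real.mul_rpow (abs_nonneg _) (by positivity), ← Real.rpow_mul hξ0,
        one_div_mul_cancel hp0.ne', Real.rpow_one]
      simp only [massDensity]; ring
    have hlind : (timeLayer σ R ×ˢ univ).indicator (massDensity σ p s ζ u R K) (t, x)
        = φ * w ^ p * l := by
      rw [hwp, hl]
      by_cases ht : t ∈ timeLayer σ R
      · rw [indicator_of_mem (by simpa using ht), indicator_of_mem ht]; simp
      · rw [indicator_of_notMem (by simpa using ht), indicator_of_notMem ht]; simp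
    have hl0 : 0 ≤ l := indicator_nonneg (fun _ _ => zero_le_one) _
    have hlr : l ≤ r := indicator_le_indicator_of_subset (timeLayer_subset σ R)
      (fun _ => zero_le_one) t
    have y1 := mul_le_young hp hw0 ha0 hμ
    have y2 := mul_le_young hp hw0 (mul_nonneg ha0 hQ0.le) (by norm_num : (0 : ℝ) < 1 / 4)
    have hr1 : r ≤ 1 := indicator_le_self' (fun _ _ => zero_le_one) t
    rw [Real.mul_rpow ha0 hQ0.le] at y2
    have hwpn : 0 ≤ w ^ p := by positivity
    have haq : 0 ≤ a ^ q := by positivity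
    calc _ ≤ |u t x| * |adjointOp σ η (fun t x => spaceTest s R K x * timeTest σ ζ R t) t x| := by
          rw [← abs_mul]; exact le_abs_self _
      _ ≤ |u t x| * (φ * (ξ ^ (1 / p) * (a * (l + Q * r)))) := by
          gcongr; exact hadj R K hR hK1 t x
      _ = φ * ((w * a) * l + (w * (a * Q)) * r) := by rw [hw]; ring
      _ ≤ φ * ((μ * w ^ p + M * a ^ q) * l + (1 / 4 * w ^ p + D * (a ^ q * Q ^ q)) * r) := by
          gcongr
      _ ≤ φ * ((μ * w ^ p) * l + (M * a ^ q) * r + 1 / 4 * w ^ p + D * (a ^ q * Q ^ q) * r) := by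
          refine mul_le_mul_of_nonneg_left ?_ hφ0.le
          have e1 : M * a ^ q * l ≤ M * a ^ q * r := by gcongr
          have e2 : 1 / 4 * w ^ p * r ≤ 1 / 4 * w ^ p := mul_le_of_le_one_right (by positivity) hr1
          linarith
      _ = μ * (φ * w ^ p * l) + 1 / 4 * (φ * w ^ p) + E * (r * φ) := by rw [hE]; ring
      _ = _ := by rw [hlind, hwp]
  have hvol : (volume.restrict ((Ioi (0 : ℝ)) ×ˢ (univ : Set (Space n)))) =
      (volume.restrict (Ioi (0 : ℝ))).prod (volume : Measure (Space n)) := by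
    rw [Measure.volume_eq_prod, ← Measure.prod_restrict, Measure.restrict_univ]
  have hrest : IntegrableOn (fun z : ℝ × Space n =>
      (timePast σ R).indicator (1 : ℝ → ℝ) z.1 * spaceTest s R K z.2) (Ioi 0 ×ˢ univ) := by
    unfold IntegrableOn
    rw [hvol]
    exact (integrableOn_timePast hR).mul_prod (integrable_spaceTest hs.1 hRK)
  have hrestint : ∫ z in (Ioi (0 : ℝ)) ×ˢ (univ : Set (Space n)),
      (timePast σ R).indicator (1 : ℝ → ℝ) z.1 * spaceTest s R K z.2
        = R ^ (2 * σ / 3) * ((R * K) ^ n * Φ) := by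
    rw [hvol, integral_prod_mul, setIntegral_timePast hR, integral_spaceTest s hRK]
  have hli := hm.indicator (measurableSet_layer (n := n) σ R)
  have hint := integral_mono (hu.integrable_linear R K hR hK1 hT)
    (((hli.const_mul μ).add (hm.const_mul (1 / 4))).add (hrest.const_mul E)) hpt
  rw [← hu.identity R K hR hK1 hT] at hint
  refine (le_of_eq_of_le rfl hint).trans ?_
  rw [integral_add' ((hli.const_mul μ).add (hm.const_mul (1 / 4))) (hrest.const_mul E),
    integral_add' (hli.const_mul μ) (hm.const_mul (1 / 4)), integral_const_mul, integral_const_mul,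
    integral_const_mul, hrestint]
  refine add_le_add le_rfl ?_
  -- the power of `R` is nonpositive exactly up to the critical exponent
  have hexp : (R ^ (-(2 * σ))) ^ q * (R ^ (2 * σ / 3) * R ^ (n : ℝ)) ≤ 1 := by
    rw [← Real.rpow_mul hR.le, ← Real.rpow_add hR, ← Real.rpow_add hR]
    refine Real.rpow_le_one_of_one_le_of_nonpos hR1 ?_
    have := exponent_nonpos (n := n) hσ hp hpc
    linarith
  have hQq : Q ^ q * K ^ (n : ℝ) = K ^ ((n : ℝ) - 2 * σ * q) := by
    rw [hQ, ← Real.rpow_mul hK.le, ← Real.rpow_add hK]; congr 1; ring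
  have hKn : 0 < K ^ (n : ℝ) := by positivity
  calc E * (R ^ (2 * σ / 3) * ((R * K) ^ n * Φ))
      = (A ^ q * Φ * (M * K ^ (n : ℝ) + D * (Q ^ q * K ^ (n : ℝ)))) *
          ((R ^ (-(2 * σ))) ^ q * (R ^ (2 * σ / 3) * R ^ (n : ℝ))) := by
        rw [hE, ha, Real.mul_rpow hA (by positivity), mul_pow, Real.rpow_natCast,
          Real.rpow_natCast]
        ring
    _ ≤ A ^ q * Φ * (M * K ^ (n : ℝ) + D * (Q ^ q * K ^ (n : ℝ))) :=
        mul_le_of_le_one_right (by positivity) hexp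
    _ ≤ A ^ q * Φ * ((1 + D) * (M * K ^ (n : ℝ) + Q ^ q * K ^ (n : ℝ))) := by
        gcongr
        have e1 : 0 ≤ D * (M * K ^ (n : ℝ)) := by positivity
        have e2 : 0 ≤ Q ^ q * K ^ (n : ℝ) := by positivity
        linarith
    _ = _ := by rw [hQq]; ring

end

/-! ### Time layers and the lifespan bound -/

section
variable {n : ℕ}

/-- The scale whose time layer is `[4^j τ / 2, 4^j τ]`. -/
noncomputable def dyadicScale (σ τ : ℝ) (j : ℕ) : ℝ := (τ * 4 ^ j) ^ (3 / (2 * σ))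

theorem dyadicScale_pos (σ : ℝ) {τ : ℝ} (hτ : 0 < τ) (j : ℕ) : 0 < dyadicScale σ τ j := by
  unfold dyadicScale; positivity

theorem dyadicScale_rpow {σ τ : ℝ} (hσ : 0 < σ) (hτ : 0 < τ) (j : ℕ) :
    dyadicScale σ τ j ^ (2 * σ / 3) = τ * 4 ^ j := by
  unfold dyadicScale
  rw [← Real.rpow_mul (by positivity), show 3 / (2 * σ) * (2 * σ / 3) = 1 by field_simp,
    Real.rpow_one]

theorem dyadicScale_mono {σ τ : ℝ} (hσ : 0 < σ) (hτ : 0 < τ) : Monotone (dyadicScale σ τ) := by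
  intro i j hij
  unfold dyadicScale
  gcongr
  norm_num

theorem mem_timeLayer_dyadicScale {σ τ : ℝ} (hσ : 0 < σ) (hτ : 0 < τ) (j : ℕ) (t : ℝ) :
    t ∈ timeLayer σ (dyadicScale σ τ j) ↔ τ * 4 ^ j / 2 ≤ t ∧ t ≤ τ * 4 ^ j := by
  have h : 0 < τ * 4 ^ j := by positivity
  change _ ≤ _ ∧ _ ≤ _ ↔ _
  rw [Real.rpow_neg (dyadicScale_pos σ hτ j).le, dyadicScale_rpow hσ hτ, inv_mul_le_iff₀ h,
    le_inv_mul_iff₀ h, mul_one, mul_one_div]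

theorem two_mul_lt_of_mem_timeLayer {σ τ t : ℝ} (hσ : 0 < σ) (hτ : 0 < τ) {i j : ℕ} (hij : i < j)
    (ht : t ∈ timeLayer σ (dyadicScale σ τ i)) : 2 * t < τ * 4 ^ j := by
  rw [mem_timeLayer_dyadicScale hσ hτ] at ht
  have h : (4 : ℝ) ^ (i + 1) ≤ 4 ^ j := pow_le_pow_right₀ (by norm_num) hij
  have h' : τ * 4 ^ (i + 1) ≤ τ * 4 ^ j := by gcongr
  have h0 : 0 < τ * 4 ^ i := by positivity
  rw [pow_succ] at h'
  linarith [ht.2]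

/-- The time layers of the dyadic scales are disjoint, so their nonlinear contributions add up to at
most the nonlinear term of a larger scale. -/
theorem sum_layerMass_le {σ p s : ℝ} (hσ : 0 < σ) (hs : 0 < s) {ζ : ℝ → ℝ} (hζ : IsTimeCutoff ζ)
    {u : ℝ → Space n → ℝ} {τ K : ℝ} (hτ : 0 < τ) (hK : 0 < K) {N : ℕ}
    (hu : ∀ j ≤ N, IntegrableOn (massDensity σ p s ζ u (dyadicScale σ τ j) K) (Ioi 0 ×ˢ univ)) :
    ∑ j ∈ Finset.range N, layerMass σ p s ζ u (dyadicScale σ τ j) K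
      ≤ mass σ p s ζ u (dyadicScale σ τ N) K := by
  unfold layerMass mass
  have hi : ∀ j ∈ Finset.range N, IntegrableOn ((timeLayer σ (dyadicScale σ τ j) ×ˢ univ).indicator
      (massDensity σ p s ζ u (dyadicScale σ τ j) K)) (Ioi 0 ×ˢ univ) := fun j hj =>
    (hu j (Finset.mem_range.1 hj).le).indicator (measurableSet_layer σ _)
  rw [← integral_finsetSum _ hi]
  refine integral_mono (integrable_finsetSum _ hi) (hu N le_rfl) ?_
  rintro ⟨t, x⟩
  simp only
  by_cases h : ∃ j ∈ Finset.range N, t ∈ timeLayer σ (dyadicScale σ τ j)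
  · obtain ⟨j, hj, hjt⟩ := h
    have hjN := Finset.mem_range.1 hj
    rw [Finset.sum_eq_single_of_mem j hj]
    · rw [indicator_of_mem (by simpa using hjt)]
      have h1 : timeTest σ ζ (dyadicScale σ τ N) t = 1 := by
        refine hζ.eq_one _ ?_
        have h0 : 0 < τ * 4 ^ N := by positivity
        rw [Real.rpow_neg (dyadicScale_pos σ hτ N).le, dyadicScale_rpow hσ hτ, inv_mul_le_iff₀ h0]
        have := two_mul_lt_of_mem_timeLayer hσ hτ hjN hjt
        linarith
      unfold massDensity
      rw [h1]
      gcongr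
      · exact hζ.nonneg _
      · exact (spaceTest_pos _ _ _ _).le
      · exact spaceTest_mono hs (dyadicScale_pos σ hτ j) (dyadicScale_mono hσ hτ hjN.le) hK x
      · exact hζ.le_one _
    · intro i _ hij
      refine indicator_of_notMem (fun hit => ?_) _
      have hit : t ∈ timeLayer σ (dyadicScale σ τ i) := by simpa using hit
      have ai := (mem_timeLayer_dyadicScale hσ hτ i t).1 hit
      have aj := (mem_timeLayer_dyadicScale hσ hτ j t).1 hjt
      rcases lt_or_gt_of_ne hij with hlt | hlt
      · linarith [two_mul_lt_of_mem_timeLayer hσ hτ hlt hit, aj.1]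
      · linarith [two_mul_lt_of_mem_timeLayer hσ hτ hlt hjt, ai.1]
  · push Not at h
    rw [Finset.sum_eq_zero fun j hj => indicator_of_notMem (by simpa using h j hj) _]
    exact massDensity_nonneg hζ u _ _ _

/-- The lifespan of every weak solution is bounded by a time depending only on the data. -/
theorem exists_lifespan_bound {σ η ε p s : ℝ} (hσ : 0 < σ) (hη : 0 ≤ η) (hε : 0 < ε)
    (hp : 1 < p) (hpc : (p : EReal) ≤ pCrit n σ) (hs : AdmissibleWeight σ s)
    {ζ : ℝ → ℝ} (hζ : IsTimeCutoff ζ) {u₀ u₁ u₂ : Space n → ℝ}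
    (hu₀ : Integrable u₀) (hu₁ : Integrable u₁) (hu₂ : Integrable u₂) (hpos : 0 < ∫ x, u₂ x) :
    ∃ Tmax : ℝ, ∀ (T : EReal) (u : ℝ → Space n → ℝ),
      IsWeakSolution σ η p ε s ζ u₀ u₁ u₂ T u → T ≤ (Tmax : EReal) := by
  obtain ⟨C, hC0, hC⟩ := exists_mass_estimate (n := n) hσ hη hp hpc hs hζ
  have hp1 : 0 < p - 1 := by linarith
  set I₂ := ∫ x, u₂ x with hI
  set δ := ε * I₂ / 2 with hδ
  have hδ0 : 0 < δ := by positivity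
  -- `K` makes the contribution of the purely spatial term small
  have hexp : 0 < -((n : ℝ) - 2 * σ * (p / (p - 1))) := by
    have := exponent_nonpos (n := n) hσ hp hpc
    have : 0 < 2 * σ / 3 := by positivity
    linarith
  obtain ⟨K, hKs, hK1⟩ : ∃ K : ℝ, C * K ^ ((n : ℝ) - 2 * σ * (p / (p - 1))) < δ / 4 ∧ 1 ≤ K := by
    have h : Filter.Tendsto (fun K : ℝ => C * K ^ ((n : ℝ) - 2 * σ * (p / (p - 1))))
        Filter.atTop (nhds 0) := by
      simpa using (tendsto_rpow_neg_atTop hexp).const_mul C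
    exact ((h.eventually (gt_mem_nhds (by positivity))).and (Filter.eventually_ge_atTop 1)).exists
  have hK : 0 < K := one_pos.trans_le hK1
  -- `μ` makes the remainder of Young's inequality small for this `K`
  obtain ⟨μ, hμs, hμ⟩ : ∃ μ : ℝ, C * (μ ^ (-(1 / (p - 1))) * K ^ (n : ℝ)) < δ / 4 ∧ 0 < μ := by
    have h : Filter.Tendsto (fun μ : ℝ => C * (μ ^ (-(1 / (p - 1))) * K ^ (n : ℝ)))
        Filter.atTop (nhds 0) := by
      simpa using ((tendsto_rpow_neg_atTop (by positivity : 0 < 1 / (p - 1))).mul_const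
        (K ^ (n : ℝ))).const_mul C
    exact ((h.eventually (gt_mem_nhds (by positivity))).and (Filter.eventually_gt_atTop 0)).exists
  obtain ⟨R₀, hR₀⟩ : ∃ R₀ : ℝ, ∀ R ≥ R₀, δ ≤ ε * dataTerm σ η s u₀ u₁ u₂ R K := by
    have h := (tendsto_dataTerm hσ hη hs hu₀ hu₁ hu₂ hK1).const_mul ε
    have hlt : δ < ε * I₂ := by rw [hδ]; linarith [mul_pos hε hpos]
    exact Filter.eventually_atTop.1 ((h.eventually (lt_mem_nhds hlt)).mono fun _ h => h.le)
  set R₁ := max R₀ 1 with hR₁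
  have hR₁1 : 1 ≤ R₁ := le_max_right _ _
  have hR₁0 : 0 < R₁ := one_pos.trans_le hR₁1
  set τ := R₁ ^ (2 * σ / 3) with hτd
  have hτ : 0 < τ := Real.rpow_pos_of_pos hR₁0 _
  have hscale0 : dyadicScale σ τ 0 = R₁ := by
    unfold dyadicScale
    rw [pow_zero, mul_one, hτd, ← Real.rpow_mul hR₁0.le,
      show 2 * σ / 3 * (3 / (2 * σ)) = 1 by field_simp, Real.rpow_one]
  have hscale : ∀ j, R₁ ≤ dyadicScale σ τ j := fun j =>
    hscale0 ▸ dyadicScale_mono hσ hτ (Nat.zero_le j)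
  set κ := δ / (2 * μ) with hκ
  have hκ0 : 0 < κ := by positivity
  set C₁ := C * ((1 / 4 : ℝ) ^ (-(1 / (p - 1))) * K ^ (n : ℝ)
    + K ^ ((n : ℝ) - 2 * σ * (p / (p - 1)))) with hC₁
  -- more layers of mass `κ` than the total mass allows
  obtain ⟨N, hN⟩ := exists_nat_gt (2 * C₁ / κ)
  rw [div_lt_iff₀ hκ0] at hN
  refine ⟨τ * 4 ^ N, fun T u hu => ?_⟩
  by_contra hT
  rw [not_le] at hT
  have hjT : ∀ j ≤ N, ((dyadicScale σ τ j ^ (2 * σ / 3) : ℝ) : EReal) < T := fun j hj => by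
    refine lt_of_le_of_lt ?_ hT
    rw [EReal.coe_le_coe_iff, dyadicScale_rpow hσ hτ]
    gcongr
    norm_num
  have hint : ∀ j ≤ N, IntegrableOn (massDensity σ p s ζ u (dyadicScale σ τ j) K)
      (Ioi 0 ×ˢ univ) := fun j hj =>
    hu.integrable_nonlinear _ K (dyadicScale_pos σ hτ j) hK1 (hjT j hj)
  have hmass0 : ∀ j, 0 ≤ mass σ p s ζ u (dyadicScale σ τ j) K := fun j =>
    integral_nonneg fun z => massDensity_nonneg hζ u _ K z
  have hdata : ∀ j, δ ≤ ε * dataTerm σ η s u₀ u₁ u₂ (dyadicScale σ τ j) K := fun j =>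
    hR₀ _ ((le_max_left _ _).trans (hscale j))
  have hup : mass σ p s ζ u (dyadicScale σ τ N) K ≤ 2 * C₁ := by
    have h := hC ε u₀ u₁ u₂ T u hu (dyadicScale σ τ N) K (1 / 4) (hR₁1.trans (hscale N)) hK1
      (hjT N le_rfl) (by norm_num)
    have hl := layerMass_le_mass hζ (hint N le_rfl)
    have := hdata N
    linarith
  have hlow : ∀ j ∈ Finset.range N, κ ≤ layerMass σ p s ζ u (dyadicScale σ τ j) K := by
    intro j hj
    have hjN := (Finset.mem_range.1 hj).le
    have h := hC ε u₀ u₁ u₂ T u hu (dyadicScale σ τ j) K μ (hR₁1.trans (hscale j)) hK1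
      (hjT j hjN) hμ
    have h1 := hdata j
    have h2 := hmass0 j
    rw [mul_add] at h
    rw [hκ, div_le_iff₀ (by positivity)]
    linarith
  have hsum := (Finset.card_nsmul_le_sum _ _ κ hlow).trans
    (sum_layerMass_le hσ hs.1 hζ hτ hK hint)
  rw [Finset.card_range, nsmul_eq_mul] at hsum
  linarith

end

end ThirdOrder


theorem mainTheorem2 (n : ℕ) (hn : 1 ≤ n) (σ η ε p s : ℝ) (hσ : 0 < σ) (hη : 1 < η) (hε : 0 < ε)
    (hp : 1 < p) (hpc : (p : EReal) ≤ ThirdOrder.pCrit n σ)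
    (hs : ThirdOrder.AdmissibleWeight σ s) (ζ : ℝ → ℝ) (hζ : ThirdOrder.IsTimeCutoff ζ)
    (u₀ u₁ u₂ : ThirdOrder.Space n → ℝ)
    (hu₀ : MeasureTheory.Integrable u₀) (hu₁ : MeasureTheory.Integrable u₁)
    (hu₂ : MeasureTheory.Integrable u₂) (hpos : 0 < ∫ x, u₂ x)
    (T : EReal) (u : ℝ → ThirdOrder.Space n → ℝ)
    (hu : ThirdOrder.IsWeakSolution σ η p ε s ζ u₀ u₁ u₂ T u) :
    ThirdOrder.BlowsUpInFiniteTime σ η p ε s ζ u₀ u₁ u₂ T u := by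
  obtain ⟨Tmax, h⟩ := ThirdOrder.exists_lifespan_bound hσ (zero_le_one.trans hη.le) hε hp hpc hs hζ
    hu₀ hu₁ hu₂ hpos
  exact ⟨Tmax, fun T' v _ hv _ => h T' v hv⟩
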